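/- Let $\rho_0\in C_c^\infty(\mathbb R^2)$, $\rho_0\not\equiv 0$, be odd in $x_2$ and satisfy $\rho_0\ge 0$ on $\mathbb R\times(0,\infty)$. A global-in-time smooth solution of the incompressible porous media (IPM) equation with initial data $\rho_0$ is a triple $(\rho,u,p)$ on $[0,\infty)\times\mathbb R^2$ with $\rho$ and $u$ of class $C^\infty$ on $[0,\infty)\times\mathbb R^2$ and $p(\cdot,t)$ of class $C^\infty$ for every $t\ge0$, such that $\rho(\cdot,0)=\rho_0$, $$\partial_t\rho+(u\cdot\nabla)\rho=0,\qquad \nabla\cdot u=0,\qquad u+\nabla p=-(0,\rho)\qquad\text{on }[0,\infty)\times\mathbb R^2,$$ $u$ is bounded on $[0,T]\times\mathbb R^2$ for every $T>0$, and $u(x,t)\to0$ as $|x|\to\infty$ for every $t\ge0$. For $s>0$ write $$\|f\|_{\dot H^s}^2=\int_{\mathbb R^2}|\xi|^{2s}|\hat f(\xi)|^2\,d\xi,\qquad \hat f(\xi)=\frac1{2\pi}\int_{\mathbb R^2}e^{-i\xi\cdot x}f(x)\,dx.$$ **Theorem 1.1.** For every $s>0$ there is a finite constant $C(s,\rho_0)$,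 depending only on $s$ and $\rho_0$, such that every global-in-time smooth solution of the IPM equation with initial data $\rho_0$ satisfies $$\int_0^\infty\|\rho(t)\|_{\dot H^s}^{-4/s}\,dt\le C(s,\rho_0).$$ Consequently, every such solution satisfies $$\limsup_{t\to\infty}t^{-s/4}\,\|\rho(t)\|_{\dot H^s}=\infty\qquad\text{for every }s>0.$$ -/

import Mathlib

/-- The plane `ℝ²` with its Euclidean structure; coordinates are `x 0` and `x 1`. -/
abbrev Plane : Type := EuclideanSpace ℝ (Fin 2)

/-- The divergence `∂₁v₁ + ∂₂v₂` of a vector field on the plane. -/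
noncomputable def planeDiv (v : Plane → Plane) (x : Plane) : ℝ :=
  ∑ i : Fin 2, fderiv ℝ v x (EuclideanSpace.single i 1) i

/-- The Fourier transform `f̂(ξ) = (2π)⁻¹ ∫ e^{-i ξ·x} f(x) dx` of an integrable function. -/
noncomputable def planeFourier (f : Plane → ℝ) (ξ : Plane) : ℂ :=
  (1 / (2 * Real.pi) : ℂ) *
    ∫ x : Plane, Complex.exp (-(Complex.I * ((inner ℝ ξ x : ℝ) : ℂ))) * (f x : ℂ)

/-- The homogeneous Sobolev norm `‖f‖_{Ḣ^s} = (∫ |ξ|^{2s} |f̂(ξ)|² dξ)^{1/2}`, with values in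
`[0, ∞]`. -/
noncomputable def hsNorm (s : ℝ) (f : Plane → ℝ) : ENNReal :=
  (∫⁻ ξ : Plane, ‖ξ‖ₑ ^ (2 * s) * ‖planeFourier f ξ‖ₑ ^ (2 : ℝ)) ^ (1 / 2 : ℝ)

/-- `(ρ, u, p)` is a global-in-time smooth solution on `[0, ∞) × ℝ²` of the incompressible porous
media equation
`∂ₜρ + (u·∇)ρ = 0`, `∇·u = 0`, `u + ∇p = -(0, ρ)`
with initial density `ρ₀`. Only the values at times `t ≥ 0` are relevant. As usual in the whole
space, the velocity vanishes at spatial infinity at each time, and is bounded on bounded time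
intervals; in particular it is the Biot-Savart velocity `∇^⊥(-Δ)⁻¹∂₁ρ`. No decay is required of
the density at positive times. -/
structure IsGlobalSmoothIPMSolution (ρ₀ : Plane → ℝ) (ρ : ℝ → Plane → ℝ)
    (u : ℝ → Plane → Plane) (p : ℝ → Plane → ℝ) : Prop where
  smooth_density : ContDiffOn ℝ ((⊤ : ℕ∞) : WithTop ℕ∞)
    (fun z : ℝ × Plane => ρ z.1 z.2) (Set.Ici 0 ×ˢ Set.univ)
  smooth_velocity : ContDiffOn ℝ ((⊤ : ℕ∞) : WithTop ℕ∞)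
    (fun z : ℝ × Plane => u z.1 z.2) (Set.Ici 0 ×ˢ Set.univ)
  smooth_pressure : ∀ t : ℝ, 0 ≤ t → ContDiff ℝ ((⊤ : ℕ∞) : WithTop ℕ∞) (p t)
  bounded_velocity : ∀ T : ℝ, ∃ M : ℝ, ∀ t ∈ Set.Icc 0 T, ∀ x : Plane, ‖u t x‖ ≤ M
  velocity_vanishes : ∀ t : ℝ, 0 ≤ t →
    Filter.Tendsto (u t) (Filter.cocompact Plane) (nhds 0)
  initial : ∀ x : Plane, ρ 0 x = ρ₀ x
  transport : ∀ t : ℝ, 0 ≤ t → ∀ x : Plane,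
    derivWithin (fun τ : ℝ => ρ τ x) (Set.Ici 0) t + inner ℝ (u t x) (gradient (ρ t) x) = 0
  incompressible : ∀ t : ℝ, 0 ≤ t → ∀ x : Plane, planeDiv (u t) x = 0
  darcy : ∀ t : ℝ, 0 ≤ t → ∀ x : Plane,
    u t x + gradient (p t) x = -(!₂[0, ρ t x] : Plane)

/-!
The potential energy `E(t) = ∫ x₂ ρ(t, x) dx` is a Lyapunov functional. It decreases at the rate
`δ(t) = ∫ η₁² / |η|² |ρ̂(t, η)|² dη = ‖∂₁ρ‖²` in `Ḣ⁻¹`, and it is nonnegative for densities which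
are odd in `x₂` and nonnegative in the upper half plane. Hence `∫₀^∞ δ(t) dt ≤ E(0)`
(`lintegral_dissipation_le`).

When `δ` is small, `ρ̂` is concentrated near the `η₂` axis: the part of the mass `∫ |ρ̂|²` outside
the cone `|η₁| ≤ λ |η|` is at most `δ / λ²`. Inside the cone and below frequency `R` the mass is at
most a constant times `‖ρ‖²_{L¹} λ R²`. Both the `L²` norm and the `L¹` bound are preserved by the
flow, so with `λ ~ √δ` and `R⁴ ~ 1 / δ` half of the mass is at frequencies above `R`, and
`‖ρ‖_{Ḣ^s}^{-4/s} ≤ C δ` (`sobolev_lower_bound`, `hsNorm_rpow_le`). Integrating in time gives the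
first claim; the second follows because `1 / t` is not integrable at infinity.

The remaining work is to justify the energy argument in a class where only the velocity is assumed
bounded and decaying.

* Taking the curl of Darcy's law, `u₁ - i u₂` solves the inhomogeneous Cauchy-Riemann equation
  `(∂₁ + i ∂₂) f = i ∂₁ρ`, as does the inverse Fourier transform of `i η₁ / (η₁ + i η₂) ρ̂`. Their
  difference is entire and vanishes at infinity (Riemann-Lebesgue), so by Liouville's theorem the
  two agree (`biotSavart`). All further information on the velocity comes from this formula, Fubini
  and Plancherel's theorem for Schwartz functions.
* As the velocity is bounded on bounded time intervals, backward characteristics exist up to time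
  zero, and the density stays compactly supported (`hasUniformSupport`).
* The odd symmetry persists since the reflected solution has the same initial density and smooth
  solutions are unique (`density_unique`, a Gronwall argument in `L²`). Then the axis `x₂ = 0` is
  invariant, and the sign of the density in the upper half plane persists (`density_nonneg`).
-/

open MeasureTheory Filter Topology
open scoped FourierTransform SchwartzMap

/-! ### The Biot-Savart law as a Fourier multiplier -/

theorem hasFDerivAt_fourierInv {k : Plane → ℂ} (hk : Integrable k)
    (hk' : Integrable fun η => ‖η‖ * ‖k η‖) (x : Plane) :
    HasFDerivAt (𝓕⁻ k)
      (-(𝓕 (VectorFourier.fourierSMulRight (innerSL ℝ) k) (-x))) x := by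
  have h1 := Real.hasFDerivAt_fourier hk hk' (-x)
  have h2 : HasFDerivAt (fun y : Plane => -y) (-ContinuousLinearMap.id ℝ Plane) x :=
    (hasFDerivAt_id x).neg
  have h3 := h1.comp x h2
  have h4 : 𝓕⁻ k = (𝓕 k) ∘ fun y => -y := by
    ext y; exact Real.fourierInv_eq_fourier_neg k y
  rw [h4]
  have h5 : 𝓕 (VectorFourier.fourierSMulRight (innerSL ℝ) k) (-x) ∘SL
      (-ContinuousLinearMap.id ℝ Plane) =
      -(𝓕 (VectorFourier.fourierSMulRight (innerSL ℝ) k) (-x)) := by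
    ext v; simp
  rw [← h5]
  exact h3

theorem fderiv_fourierInv_apply {k : Plane → ℂ} (hk : Integrable k)
    (hk' : Integrable fun η => ‖η‖ * ‖k η‖) (x v : Plane) :
    fderiv ℝ (𝓕⁻ k) x v =
      𝓕⁻ (fun η => 2 * Real.pi * Complex.I * ((inner ℝ η v : ℝ) : ℂ) * k η) x := by
  have hint : Integrable (VectorFourier.fourierSMulRight (innerSL ℝ) k) := by
    refine Integrable.mono' (g := fun η => 2 * Real.pi * ‖innerSL ℝ (E := Plane)‖ * (‖η‖ * ‖k η‖))
      (hk'.const_mul _) hk.1.fourierSMulRight (ae_of_all _ fun η => ?_)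
    refine (VectorFourier.norm_fourierSMulRight_le _ _ _).trans (le_of_eq ?_)
    ring
  rw [(hasFDerivAt_fourierInv hk hk' x).fderiv, neg_apply,
    Real.fourier_continuousLinearMap_apply hint, Real.fourierInv_eq_fourier_neg, Real.fourier_eq,
    Real.fourier_eq, ← integral_neg]
  congr 1
  ext η
  rw [← smul_neg]
  congr 1
  have h : innerSL ℝ η v = inner ℝ η v := rfl
  simp only [VectorFourier.fourierSMulRight_apply, smul_eq_mul, Complex.real_smul, h]
  ring

/-- The inverse Fourier transform is symmetric for the bilinear pairing. Apart from integrability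
nothing is assumed on `k`, which allows the discontinuous `velocitySymbol` as a factor. -/
theorem integral_fourierInv_mul {k g : Plane → ℂ} (hk : Integrable k) (hg : Integrable g) :
    ∫ x, 𝓕⁻ k x * g x = ∫ η, k η * 𝓕⁻ g η := by
  have h := VectorFourier.integral_fourierIntegral_smul_eq_flip (𝕜 := ℝ)
    (L := -(innerₗ Plane)) (μ := volume) (ν := volume) Real.continuous_fourierChar
    (by simp only [LinearMap.neg_apply, innerₗ_apply_apply]; fun_prop) hk hg
  have e1 : ∀ f : Plane → ℂ,
      VectorFourier.fourierIntegral 𝐞 volume (-(innerₗ Plane)) f = 𝓕⁻ f := by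
    intro f; ext w
    simp [VectorFourier.fourierIntegral, Real.fourierInv_eq]
  have e2 : ∀ f : Plane → ℂ,
      VectorFourier.fourierIntegral 𝐞 volume (-(innerₗ Plane)).flip f = 𝓕⁻ f := by
    intro f; ext w
    simp [VectorFourier.fourierIntegral, Real.fourierInv_eq, real_inner_comm]
  simpa only [e1, e2, smul_eq_mul] using h

/-- The Riemann-Lebesgue lemma for the inverse Fourier transform. -/
theorem tendsto_fourierInv_cocompact (k : Plane → ℂ) :
    Tendsto (𝓕⁻ k) (cocompact Plane) (𝓝 0) := by
  have h := tendsto_integral_exp_inner_smul_cocompact k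
  have h2 := h.comp (Homeomorph.neg Plane).isClosedEmbedding.tendsto_cocompact
  refine h2.congr fun x => ?_
  simp [Real.fourierInv_eq]

/-- A differentiable `h : ℝ² → ℂ` with `∂₂h = i ∂₁h` which vanishes at infinity is zero. -/
theorem eq_zero_of_cauchyRiemann {h : Plane → ℂ} (hd : Differentiable ℝ h)
    (hCR : ∀ x, fderiv ℝ h x (EuclideanSpace.single 1 1) =
      Complex.I * fderiv ℝ h x (EuclideanSpace.single 0 1))
    (hlim : Tendsto h (cocompact Plane) (𝓝 0)) (x : Plane) : h x = 0 := by
  let e : ℂ ≃ₗᵢ[ℝ] Plane := Complex.orthonormalBasisOneI.repr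
  have he1 : e 1 = EuclideanSpace.single 0 1 := by
    have := Complex.orthonormalBasisOneI.repr_self 0
    simpa using this
  have heI : e Complex.I = EuclideanSpace.single 1 1 := by
    have := Complex.orthonormalBasisOneI.repr_self 1
    simpa using this
  have hfd : ∀ z, HasFDerivAt (h ∘ e) ((fderiv ℝ h (e z)).comp
      (e.toContinuousLinearEquiv : ℂ →L[ℝ] Plane)) z := fun z =>
    (hd (e z)).hasFDerivAt.comp z e.toContinuousLinearEquiv.hasFDerivAt
  have hdiff : Differentiable ℂ (h ∘ e) := by
    intro z
    rw [differentiableAt_complex_iff_differentiableAt_real]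
    refine ⟨(hfd z).differentiableAt, ?_⟩
    rw [(hfd z).fderiv]
    simp [he1, heI, hCR]
  have hl : Tendsto (h ∘ e) (cocompact ℂ) (𝓝 0) :=
    hlim.comp e.toHomeomorph.isClosedEmbedding.tendsto_cocompact
  have := hdiff.apply_eq_of_tendsto_cocompact (e.symm x) hl
  simpa using this

/-- The Fourier multiplier `i η₁ / (η₁ + i η₂)` which sends the density `ρ` to the complex
velocity `u₁ - i u₂`. Its value at `η = 0` is `0`. -/
noncomputable def velocitySymbol (η : Plane) : ℂ :=
  Complex.I * (η 0 : ℂ) / ((η 0 : ℂ) + Complex.I * (η 1 : ℂ))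

theorem velocitySymbol_mul (η : Plane) :
    ((η 0 : ℂ) + Complex.I * (η 1 : ℂ)) * velocitySymbol η = Complex.I * (η 0 : ℂ) := by
  unfold velocitySymbol
  by_cases h : (η 0 : ℂ) + Complex.I * (η 1 : ℂ) = 0
  · have : (η 0 : ℝ) = 0 := by
      have := congrArg Complex.re h
      simpa using this
    simp [this]
  · field_simp

theorem norm_velocitySymbol_le (η : Plane) : ‖velocitySymbol η‖ ≤ 1 := by
  unfold velocitySymbol
  rw [norm_div, norm_mul, Complex.norm_I, one_mul]
  refine div_le_one_of_le₀ ?_ (norm_nonneg _)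
  have := Complex.abs_re_le_norm ((η 0 : ℂ) + Complex.I * (η 1 : ℂ))
  simpa using this

theorem norm_sq_plane (η : Plane) : ‖η‖ ^ 2 = η 0 ^ 2 + η 1 ^ 2 := by
  rw [EuclideanSpace.norm_sq_eq]
  simp [Fin.sum_univ_two]

theorem im_velocitySymbol (η : Plane) : (velocitySymbol η).im = η 0 ^ 2 / ‖η‖ ^ 2 := by
  unfold velocitySymbol
  rw [norm_sq_plane, Complex.div_im]
  simp [Complex.normSq_apply]
  ring

theorem measurable_velocitySymbol : Measurable velocitySymbol := by
  unfold velocitySymbol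
  fun_prop

/-- The complexification of a smooth compactly supported real function, as a Schwartz function. -/
noncomputable def schwartzOfReal (θ : Plane → ℝ) (hθ : ContDiff ℝ ((⊤ : ℕ∞) : WithTop ℕ∞) θ)
    (hc : HasCompactSupport θ) : 𝓢(Plane, ℂ) :=
  HasCompactSupport.toSchwartzMap (f := fun x => (θ x : ℂ))
    (hc.comp_left (g := fun r : ℝ => (r : ℂ)) (by simp))
    (Complex.ofRealCLM.contDiff.comp hθ)

section velocity

variable (S : 𝓢(Plane, ℂ))

theorem integrable_pow_mul_symbol (n : ℕ) :
    Integrable fun η => ‖η‖ ^ n * ‖velocitySymbol η * 𝓕 S η‖ := by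
  refine Integrable.mono' ((𝓕 S).integrable_pow_mul volume n) ?_ (ae_of_all _ fun η => ?_)
  · have := measurable_velocitySymbol
    have h2 : Measurable fun η => 𝓕 S η := (𝓕 S).continuous.measurable
    fun_prop
  · rw [norm_mul, norm_norm, norm_mul, norm_pow, norm_norm]
    have := norm_velocitySymbol_le η
    gcongr
    exact mul_le_of_le_one_left (norm_nonneg _) this

theorem integrable_symbol_mul : Integrable fun η => velocitySymbol η * 𝓕 S η := by
  have h := integrable_pow_mul_symbol S 0
  simp only [pow_zero, one_mul] at h
  refine (integrable_norm_iff ?_).1 h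
  exact (measurable_velocitySymbol.mul (𝓕 S).continuous.measurable).aestronglyMeasurable

/-- The complex velocity `V = u₁ - i u₂` given by the Biot-Savart law solves
`∂₁V + i ∂₂V = i ∂₁θ`. -/
theorem velocity_fderiv (x : Plane) :
    fderiv ℝ (𝓕⁻ fun η => velocitySymbol η * 𝓕 S η) x (EuclideanSpace.single 0 1) +
      Complex.I * fderiv ℝ (𝓕⁻ fun η => velocitySymbol η * 𝓕 S η) x (EuclideanSpace.single 1 1) =
    Complex.I * fderiv ℝ S x (EuclideanSpace.single 0 1) := by
  have hk := integrable_symbol_mul S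
  have hk' : Integrable fun η => ‖η‖ * ‖velocitySymbol η * 𝓕 S η‖ := by
    simpa using integrable_pow_mul_symbol S 1
  have hS : (S : Plane → ℂ) = 𝓕⁻ fun η => 𝓕 S η := by
    have : 𝓕⁻ (𝓕 S) = S := FourierTransform.fourierInv_fourier_eq S
    conv_lhs => rw [← this]
    rw [SchwartzMap.fourierInv_coe]
  have hs' : Integrable fun η => ‖η‖ * ‖𝓕 S η‖ := by
    have h := (𝓕 S).integrable_pow_mul volume 1
    simp only [pow_one] at h
    exact h
  have hw : ∀ v : Plane, Integrable fun η => 2 * Real.pi * Complex.I * ((inner ℝ η v : ℝ) : ℂ) *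
      (velocitySymbol η * 𝓕 S η) := by
    intro v
    refine Integrable.mono' (hk'.const_mul (2 * Real.pi * ‖v‖)) ?_ (ae_of_all _ fun η => ?_)
    · have := measurable_velocitySymbol
      have h2 : Measurable fun η => 𝓕 S η := (𝓕 S).continuous.measurable
      have h3 : Measurable fun η : Plane => (inner ℝ η v : ℝ) := by fun_prop
      refine Measurable.aestronglyMeasurable ?_
      fun_prop
    · rw [norm_mul]
      have : ‖2 * (Real.pi : ℂ) * Complex.I * ((inner ℝ η v : ℝ) : ℂ)‖ ≤
          2 * Real.pi * ‖v‖ * ‖η‖ := by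
        have := abs_real_inner_le_norm η v
        simp [abs_of_pos Real.pi_pos]
        nlinarith [Real.pi_pos]
      calc _ ≤ (2 * Real.pi * ‖v‖ * ‖η‖) * ‖velocitySymbol η * 𝓕 S η‖ := by gcongr
        _ = _ := by ring
  have hw' : ∀ v w : Plane, Integrable fun η => 𝐞 (inner ℝ η w) •
      (2 * Real.pi * Complex.I * ((inner ℝ η v : ℝ) : ℂ) * (velocitySymbol η * 𝓕 S η)) := by
    intro v w
    have := (Real.fourierIntegral_convergent_iff (-w)).2 (hw v)
    simpa using this
  conv_rhs => rw [hS, fderiv_fourierInv_apply (𝓕 S).integrable hs']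
  rw [fderiv_fourierInv_apply hk hk', fderiv_fourierInv_apply hk hk']
  simp only [Real.fourierInv_eq]
  rw [← integral_const_mul, ← integral_const_mul, ← integral_add (hw' _ x) ((hw' _ x).const_mul _)]
  congr 1
  ext η
  simp only [EuclideanSpace.inner_single_right, Circle.smul_def, smul_eq_mul]
  have := velocitySymbol_mul η
  simp
  linear_combination (𝐞 (inner ℝ η x) : ℂ) * 2 * Real.pi * Complex.I * 𝓕 S η * this

end velocity

/-- **Biot-Savart law.** A divergence free field with curl `-∂₁θ` which vanishes at infinity is
given by the Fourier multiplier `velocitySymbol`. -/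
theorem biotSavart {θ : Plane → ℝ} (S : 𝓢(Plane, ℂ)) (hS : ∀ x, S x = (θ x : ℂ))
    (hθ : Differentiable ℝ θ)
    {w : Plane → Plane} (hw : Differentiable ℝ w) (hlim : Tendsto w (cocompact Plane) (𝓝 0))
    (hdiv : ∀ x, planeDiv w x = 0)
    (hcurl : ∀ x, fderiv ℝ w x (EuclideanSpace.single 0 1) 1 -
      fderiv ℝ w x (EuclideanSpace.single 1 1) 0 = -fderiv ℝ θ x (EuclideanSpace.single 0 1))
    (x : Plane) :
    (w x 0 : ℂ) - Complex.I * (w x 1 : ℂ) = 𝓕⁻ (fun η => velocitySymbol η * 𝓕 S η) x := by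
  set V := 𝓕⁻ (fun η => velocitySymbol η * 𝓕 S η) with hV
  have hVd : Differentiable ℝ V := fun x =>
    (hasFDerivAt_fourierInv (integrable_symbol_mul S)
      (by simpa using integrable_pow_mul_symbol S 1) x).differentiableAt
  let A : Plane →L[ℝ] ℂ := Complex.ofRealCLM.comp (EuclideanSpace.proj 0) -
    Complex.I • Complex.ofRealCLM.comp (EuclideanSpace.proj 1)
  have hA : ∀ y : Plane, A y = (y 0 : ℂ) - Complex.I * (y 1 : ℂ) := by intro y; simp [A]
  have hfd : ∀ x, HasFDerivAt (fun x => A (w x) - V x) (A.comp (fderiv ℝ w x) - fderiv ℝ V x) x :=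
    fun x => (A.hasFDerivAt.comp x (hw x).hasFDerivAt).sub (hVd x).hasFDerivAt
  have hSd : ∀ x v, fderiv ℝ S x v = (fderiv ℝ θ x v : ℂ) := by
    intro x v
    have h1 : (S : Plane → ℂ) = fun x => Complex.ofRealCLM (θ x) := by ext y; simp [hS]
    have h2 : HasFDerivAt (fun x => Complex.ofRealCLM (θ x))
        (Complex.ofRealCLM.comp (fderiv ℝ θ x)) x :=
      Complex.ofRealCLM.hasFDerivAt.comp x (hθ x).hasFDerivAt
    rw [h1, h2.fderiv]; simp
  have key := eq_zero_of_cauchyRiemann (h := fun x => A (w x) - V x)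
    (fun x => (hfd x).differentiableAt) ?_ ?_ x
  · simp only [hA] at key
    linear_combination key
  · intro x
    rw [(hfd x).fderiv]
    have h1 := velocity_fderiv S x
    rw [← hV, hSd] at h1
    have h2 := hdiv x
    have h3 := hcurl x
    simp only [planeDiv, Fin.sum_univ_two] at h2
    have h2' := congrArg (fun r : ℝ => (r : ℂ)) h2
    have h3' := congrArg (fun r : ℝ => (r : ℂ)) h3
    push_cast at h2' h3'
    simp only [sub_apply, ContinuousLinearMap.comp_apply, hA]
    linear_combination Complex.I * h1 - Complex.I * h2' - h3' +
      ((fderiv ℝ w x (EuclideanSpace.single 0 1) 1 : ℂ) +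
        (fderiv ℝ θ x (EuclideanSpace.single 0 1) : ℂ)
        - fderiv ℝ V x (EuclideanSpace.single 1 1)) * Complex.I_sq
  · have := ((A.continuous.tendsto 0).comp hlim).sub
      (tendsto_fourierInv_cocompact _ : Tendsto V _ _)
    simpa using this

/-! ### Quadratic identities for the velocity, and the curl of Darcy's law -/

theorem fourierInv_eq_conj {S : 𝓢(Plane, ℂ)} {θ : Plane → ℝ} (hS : ∀ x, S x = (θ x : ℂ))
    (η : Plane) : 𝓕⁻ (S : Plane → ℂ) η = (starRingEnd ℂ) (𝓕 S η) := by
  rw [SchwartzMap.fourier_coe, Real.fourierInv_eq', Real.fourier_eq', ← integral_conj]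
  congr 1
  ext x
  simp only [hS, smul_eq_mul, map_mul, Complex.conj_ofReal, ← Complex.exp_conj, Complex.conj_I]
  congr 2
  push_cast
  ring

theorem integral_sq_fourier {S : 𝓢(Plane, ℂ)} {θ : Plane → ℝ} (hS : ∀ x, S x = (θ x : ℂ)) :
    ∫ η, ‖𝓕 S η‖ ^ 2 = ∫ x, θ x ^ 2 := by
  rw [SchwartzMap.integral_norm_sq_fourier]
  simp [hS]

theorem integrable_sq_fourier (S : 𝓢(Plane, ℂ)) : Integrable fun η => ‖𝓕 S η‖ ^ 2 := by
  have := ((𝓕 S).memLp 2).integrable_norm_pow (by norm_num)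
  simpa using this

/-- The potential energy identity: testing the vertical velocity against the density gives minus
the square of the `Ḣ^{-1}` norm of `∂₁θ`. -/
theorem integral_mul_velocity {θ : Plane → ℝ} (S : 𝓢(Plane, ℂ)) (hS : ∀ x, S x = (θ x : ℂ))
    (hc : HasCompactSupport θ) (hθ : Continuous θ)
    {w : Plane → Plane} (hw : Continuous w)
    (hBS : ∀ x, (w x 0 : ℂ) - Complex.I * (w x 1 : ℂ) =
      𝓕⁻ (fun η => velocitySymbol η * 𝓕 S η) x) :
    ∫ x, θ x * w x 1 = -∫ η : Plane, η 0 ^ 2 / ‖η‖ ^ 2 * ‖𝓕 S η‖ ^ 2 := by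
  have h1 := integral_fourierInv_mul (integrable_symbol_mul S) S.integrable
  have hL : Integrable fun x => 𝓕⁻ (fun η => velocitySymbol η * 𝓕 S η) x * S x := by
    simp only [← hBS, hS]
    refine Continuous.integrable_of_hasCompactSupport (by fun_prop) ?_
    exact (hc.comp_left (g := fun r : ℝ => (r : ℂ)) (by simp)).mul_left
  have hR : Integrable fun η => velocitySymbol η * 𝓕 S η * 𝓕⁻ (S : Plane → ℂ) η := by
    have h3 : Integrable fun η => velocitySymbol η * ((‖𝓕 S η‖ ^ 2 : ℝ) : ℂ) :=
      ((integrable_sq_fourier S).ofReal (𝕜 := ℂ)).bdd_mul (c := 1)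
        measurable_velocitySymbol.aestronglyMeasurable (ae_of_all _ norm_velocitySymbol_le)
    refine h3.congr (ae_of_all _ fun η => ?_)
    simp only [fourierInv_eq_conj hS]
    rw [mul_assoc, Complex.mul_conj, Complex.normSq_eq_norm_sq]
  have h2 := congrArg Complex.im h1
  have e1 := Complex.imCLM.integral_comp_comm hL
  have e2 := Complex.imCLM.integral_comp_comm hR
  simp only [Complex.imCLM_apply] at e1 e2
  rw [← e1, ← e2] at h2
  rw [eq_neg_iff_add_eq_zero, ← neg_eq_iff_add_eq_zero, ← integral_neg]
  convert h2 using 3 with x η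
  · rw [← hBS, hS]; simp; ring
  · rw [fourierInv_eq_conj hS, mul_assoc, Complex.mul_conj, Complex.normSq_eq_norm_sq,
      Complex.im_mul_ofReal, im_velocitySymbol]

/-- The velocity is bounded by the density in `L²`, in the form tested against a field `h`. -/
theorem abs_integral_inner_velocity_le {θ : Plane → ℝ} (S : 𝓢(Plane, ℂ))
    (hS : ∀ x, S x = (θ x : ℂ)) {w : Plane → Plane} (hw : Continuous w)
    (hBS : ∀ x, (w x 0 : ℂ) - Complex.I * (w x 1 : ℂ) =
      𝓕⁻ (fun η => velocitySymbol η * 𝓕 S η) x)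
    {h : Plane → Plane} (hh : ContDiff ℝ ((⊤ : ℕ∞) : WithTop ℕ∞) h) (hc : HasCompactSupport h) :
    |∫ x, inner ℝ (w x) (h x)| ≤ 1 / 2 * ((∫ x, θ x ^ 2) + ∫ x, ‖h x‖ ^ 2) := by
  let B : Plane →L[ℝ] ℂ := Complex.ofRealCLM.comp (EuclideanSpace.proj 0) +
    Complex.I • Complex.ofRealCLM.comp (EuclideanSpace.proj 1)
  have hB : ∀ y : Plane, B y = (y 0 : ℂ) + Complex.I * (y 1 : ℂ) := by intro y; simp [B]
  let G : 𝓢(Plane, ℂ) := HasCompactSupport.toSchwartzMap (f := fun x => B (h x))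
    (hc.comp_left (g := B) (by simp)) (B.contDiff.comp hh)
  have hG : ∀ x, G x = (h x 0 : ℂ) + Complex.I * (h x 1 : ℂ) := fun x => hB (h x)
  have hGn : ∀ x, ‖G x‖ ^ 2 = ‖h x‖ ^ 2 := by
    intro x
    rw [hG, norm_sq_plane, ← Complex.normSq_eq_norm_sq]
    simp [Complex.normSq_apply]
    ring
  have hL : Integrable fun x => 𝓕⁻ (fun η => velocitySymbol η * 𝓕 S η) x * G x := by
    simp only [← hBS]
    refine Continuous.integrable_of_hasCompactSupport
      (Continuous.mul (by fun_prop) G.continuous) (HasCompactSupport.mul_left ?_)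
    exact hc.comp_left (g := B) (by simp)
  have h1 := integral_fourierInv_mul (integrable_symbol_mul S) G.integrable
  have e1 := Complex.reCLM.integral_comp_comm hL
  simp only [Complex.reCLM_apply] at e1
  have e3 : ∫ x, inner ℝ (w x) (h x) =
      (∫ η, velocitySymbol η * 𝓕 S η * 𝓕⁻ (G : Plane → ℂ) η).re := by
    rw [← h1, ← e1]
    congr 1
    ext x
    rw [← hBS, hG, PiLp.inner_apply]
    simp [Fin.sum_univ_two]
    ring
  have e4 : ∫ η, ‖𝓕⁻ (G : Plane → ℂ) η‖ ^ 2 = ∫ x, ‖h x‖ ^ 2 := by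
    have := SchwartzMap.integral_norm_sq_fourier (𝓕⁻ G)
    rw [FourierTransform.fourier_fourierInv_eq] at this
    rw [← SchwartzMap.fourierInv_coe, ← this]
    simp only [hGn]
  have i4 : Integrable fun η => ‖𝓕⁻ (G : Plane → ℂ) η‖ ^ 2 := by
    have := ((𝓕⁻ G).memLp 2).integrable_norm_pow (by norm_num)
    rw [SchwartzMap.fourierInv_coe] at this
    simpa using this
  rw [e3]
  calc _ ≤ ‖∫ η, velocitySymbol η * 𝓕 S η * 𝓕⁻ (G : Plane → ℂ) η‖ := Complex.abs_re_le_norm _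
    _ ≤ ∫ η, (1 / 2 * (‖𝓕 S η‖ ^ 2 + ‖𝓕⁻ (G : Plane → ℂ) η‖ ^ 2)) := by
      refine norm_integral_le_of_norm_le (((integrable_sq_fourier S).add i4).const_mul _)
        (ae_of_all _ fun η => ?_)
      rw [norm_mul, norm_mul]
      have h5 := norm_velocitySymbol_le η
      have h6 : ‖velocitySymbol η‖ * ‖𝓕 S η‖ ≤ ‖𝓕 S η‖ :=
        mul_le_of_le_one_left (norm_nonneg _) h5
      have h7 := norm_nonneg (𝓕⁻ (G : Plane → ℂ) η)
      nlinarith [sq_nonneg (‖𝓕 S η‖ - ‖𝓕⁻ (G : Plane → ℂ) η‖)]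
    _ = _ := by
      rw [integral_const_mul, integral_add (integrable_sq_fourier S) i4, e4, integral_sq_fourier hS]

theorem gradient_apply (f : Plane → ℝ) (x : Plane) (i : Fin 2) :
    gradient f x i = fderiv ℝ f x (EuclideanSpace.single i 1) := by
  have h1 : (inner ℝ (gradient f x) (EuclideanSpace.single i 1) : ℝ) =
      fderiv ℝ f x (EuclideanSpace.single i 1) := by
    simp [gradient]
  rw [← h1, EuclideanSpace.inner_single_right]
  simp

/-- Taking the curl in Darcy's law. -/
theorem curl_of_darcy {w : Plane → Plane} {θ q : Plane → ℝ} (hθ : Differentiable ℝ θ)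
    (hq : ContDiff ℝ ((⊤ : ℕ∞) : WithTop ℕ∞) q)
    (h : ∀ x, w x + gradient q x = -(!₂[0, θ x] : Plane)) (hw : Differentiable ℝ w) (x : Plane) :
    fderiv ℝ w x (EuclideanSpace.single 0 1) 1 -
      fderiv ℝ w x (EuclideanSpace.single 1 1) 0 = -fderiv ℝ θ x (EuclideanSpace.single 0 1) := by
  have hq' : ContDiff ℝ 2 q := contDiff_infty.1 hq 2
  have hq2 : Differentiable ℝ (fderiv ℝ q) :=
    (hq'.fderiv_right (m := 1) (by norm_num)).differentiable (by simp)
  have hsymm : IsSymmSndFDerivAt ℝ q x := hq'.contDiffAt.isSymmSndFDerivAt (by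
    simp [minSmoothness_of_isRCLikeNormedField])
  have c0 : ∀ y, w y 0 = -fderiv ℝ q y (EuclideanSpace.single 0 1) := by
    intro y
    have := congrArg (fun v : Plane => v 0) (h y)
    simp [gradient_apply] at this
    linarith
  have c1 : ∀ y, w y 1 = -θ y - fderiv ℝ q y (EuclideanSpace.single 1 1) := by
    intro y
    have := congrArg (fun v : Plane => v 1) (h y)
    simp [gradient_apply] at this
    linarith
  have pr : ∀ (i : Fin 2) (v : Plane), fderiv ℝ w x v i = fderiv ℝ (fun y => w y i) x v := by
    intro i v
    have := ((EuclideanSpace.proj (𝕜 := ℝ) i).hasFDerivAt.comp x (hw x).hasFDerivAt).fderiv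
    have e : (fun y => w y i) = (EuclideanSpace.proj (𝕜 := ℝ) i : Plane →L[ℝ] ℝ) ∘ w := rfl
    rw [e, this]; rfl
  have d : ∀ v z, HasFDerivAt (fun y => fderiv ℝ q y v)
      ((ContinuousLinearMap.apply ℝ ℝ v).comp (fderiv ℝ (fderiv ℝ q) z)) z := fun v z =>
    (ContinuousLinearMap.apply ℝ ℝ v).hasFDerivAt.comp z (hq2 z).hasFDerivAt
  have d0 : HasFDerivAt (fun y => -fderiv ℝ q y (EuclideanSpace.single 0 1)) _ x := (d _ x).neg
  have d1 : HasFDerivAt (fun y => -θ y - fderiv ℝ q y (EuclideanSpace.single 1 1)) _ x :=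
    (hθ x).hasFDerivAt.neg.sub (d _ x)
  rw [pr, pr, funext c0, funext c1, d0.fderiv, d1.fderiv]
  have := hsymm (EuclideanSpace.single 0 1) (EuclideanSpace.single 1 1)
  simp only [sub_apply, neg_apply, ContinuousLinearMap.comp_apply, ContinuousLinearMap.apply_apply]
  rw [this]
  ring

/-! ### Calculus on the half space-time -/

/-- The closed half of space-time on which solutions live. -/
abbrev spaceTime : Set (ℝ × Plane) := Set.Ici 0 ×ˢ Set.univ

theorem uniqueDiffOn_spaceTime : UniqueDiffOn ℝ spaceTime :=
  (uniqueDiffOn_Ici 0).prod uniqueDiffOn_univ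

section spaceTime

variable {G : Type*} [NormedAddCommGroup G] [NormedSpace ℝ G] {F : ℝ → Plane → G}

/-- The space-time derivative of a function on `[0, ∞) × ℝ²`, one-sided at time zero. -/
noncomputable def spaceTimeDeriv (F : ℝ → Plane → G) (t : ℝ) (x : Plane) : ℝ × Plane →L[ℝ] G :=
  fderivWithin ℝ (fun z : ℝ × Plane => F z.1 z.2) spaceTime (t, x)

variable (hF : ContDiffOn ℝ ((⊤ : ℕ∞) : WithTop ℕ∞) (fun z : ℝ × Plane => F z.1 z.2) spaceTime)
include hF

theorem continuousOn_spaceTimeDeriv :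
    ContinuousOn (fun z : ℝ × Plane => spaceTimeDeriv F z.1 z.2) spaceTime :=
  hF.continuousOn_fderivWithin uniqueDiffOn_spaceTime (by simp)

theorem hasFDerivWithinAt_spaceTime {t : ℝ} (ht : 0 ≤ t) (x : Plane) :
    HasFDerivWithinAt (fun z : ℝ × Plane => F z.1 z.2) (spaceTimeDeriv F t x) spaceTime (t, x) :=
  ((hF.differentiableOn (by simp)) (t, x) ⟨ht, trivial⟩).hasFDerivWithinAt

theorem contDiff_slice {t : ℝ} (ht : 0 ≤ t) : ContDiff ℝ ((⊤ : ℕ∞) : WithTop ℕ∞) (F t) :=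
  hF.comp_contDiff (f := fun x => (t, x)) (contDiff_const.prodMk contDiff_id)
    fun _ => ⟨ht, trivial⟩

theorem hasFDerivAt_slice {t : ℝ} (ht : 0 ≤ t) (x : Plane) :
    HasFDerivAt (F t) ((spaceTimeDeriv F t x).comp (ContinuousLinearMap.inr ℝ ℝ Plane)) x :=
  (hasFDerivWithinAt_spaceTime hF ht x).comp_hasFDerivAt x (f := fun y => (t, y))
    (hasFDerivAt_prodMk_right t x) (Eventually.of_forall fun _ => ⟨ht, trivial⟩)

theorem fderiv_slice {t : ℝ} (ht : 0 ≤ t) (x v : Plane) :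
    fderiv ℝ (F t) x v = spaceTimeDeriv F t x (0, v) := by
  rw [(hasFDerivAt_slice hF ht x).fderiv]; simp

/-- The chain rule along a curve in space-time. -/
theorem hasDerivWithinAt_along {s : Set ℝ} (hs : s ⊆ Set.Ici 0) {X : ℝ → Plane} {v : Plane}
    {t : ℝ} (ht : t ∈ s) (hX : HasDerivWithinAt X v s t) :
    HasDerivWithinAt (fun τ => F τ (X τ)) (spaceTimeDeriv F t (X t) (1, v)) s t :=
  (hasFDerivWithinAt_spaceTime hF (hs ht) (X t)).comp_hasDerivWithinAt t
    (f := fun τ => (τ, X τ)) ((hasDerivWithinAt_id t s).prodMk hX) fun _ hτ => ⟨hs hτ, trivial⟩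

theorem hasDerivWithinAt_time {t : ℝ} (ht : 0 ≤ t) (x : Plane) :
    HasDerivWithinAt (fun τ => F τ x) (spaceTimeDeriv F t x (1, 0)) (Set.Ici 0) t :=
  hasDerivWithinAt_along hF subset_rfl (X := fun _ => x) ht (hasDerivWithinAt_const _ _ _)

theorem derivWithin_time {t : ℝ} (ht : 0 ≤ t) (x : Plane) :
    derivWithin (fun τ => F τ x) (Set.Ici 0) t = spaceTimeDeriv F t x (1, 0) :=
  (hasDerivWithinAt_time hF ht x).derivWithin (uniqueDiffOn_Ici 0 t ht)

theorem hasDerivAt_time {t : ℝ} (ht : 0 < t) (x : Plane) :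
    HasDerivAt (fun τ => F τ x) (spaceTimeDeriv F t x (1, 0)) t :=
  (hasDerivWithinAt_time hF ht.le x).hasDerivAt (Ici_mem_nhds ht)

theorem exists_bound_spaceTimeDeriv (T R : ℝ) (c : Plane) :
    ∃ C, ∀ t ∈ Set.Icc 0 T, ∀ x ∈ Metric.closedBall c R, ‖spaceTimeDeriv F t x‖ ≤ C := by
  have hK : IsCompact (Set.Icc 0 T ×ˢ Metric.closedBall c R) :=
    isCompact_Icc.prod (isCompact_closedBall _ _)
  obtain ⟨C, hC⟩ := hK.exists_bound_of_continuousOn ((continuousOn_spaceTimeDeriv hF).mono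
    (Set.prod_mono (fun _ h => h.1) (Set.subset_univ _)))
  exact ⟨C, fun t ht x hx => hC (t, x) ⟨ht, hx⟩⟩

theorem exists_lipschitzOnWith (T R : ℝ) (c : Plane) :
    ∃ K : NNReal, ∀ t ∈ Set.Icc 0 T, LipschitzOnWith K (F t) (Metric.closedBall c R) := by
  obtain ⟨C, hC⟩ := exists_bound_spaceTimeDeriv hF T R c
  refine ⟨C.toNNReal, fun t ht => Convex.lipschitzOnWith_of_nnnorm_fderiv_le (𝕜 := ℝ)
    (fun x _ => (hasFDerivAt_slice hF ht.1 x).differentiableAt) (fun x hx => ?_)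
    (convex_closedBall _ _)⟩
  rw [(hasFDerivAt_slice hF ht.1 x).fderiv]
  have h1 := hC t ht x hx
  have h2 : ‖(spaceTimeDeriv F t x).comp (ContinuousLinearMap.inr ℝ ℝ Plane)‖ ≤
      ‖spaceTimeDeriv F t x‖ := by
    refine ContinuousLinearMap.opNorm_le_bound _ (norm_nonneg _) fun v => ?_
    have := (spaceTimeDeriv F t x).le_opNorm (0, v)
    simpa [Prod.norm_def] using this
  rw [← NNReal.coe_le_coe, coe_nnnorm, Real.coe_toNNReal _ ((norm_nonneg _).trans h1)]
  exact h2.trans h1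

end spaceTime

section integral

/-- The supports of `F t`, for `t` in bounded intervals, lie in a common ball. -/
def HasUniformSupport (F : ℝ → Plane → ℝ) : Prop :=
  ∀ T : ℝ, ∃ R : ℝ, ∀ t ∈ Set.Icc 0 T, ∀ x : Plane, R < ‖x‖ → F t x = 0

variable {F : ℝ → Plane → ℝ}

theorem HasUniformSupport.hasCompactSupport (h : HasUniformSupport F) {t : ℝ} (ht : 0 ≤ t) :
    HasCompactSupport (F t) := by
  obtain ⟨R, hR⟩ := h t
  refine HasCompactSupport.of_support_subset_isCompact (isCompact_closedBall (0 : Plane) R) ?_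
  intro x hx
  by_contra hx'
  exact hx (hR t ⟨ht, le_rfl⟩ x (by simpa using hx'))

theorem HasUniformSupport.mono (h : HasUniformSupport F) {F' : ℝ → Plane → ℝ}
    (hz : ∀ t x, F t x = 0 → F' t x = 0) : HasUniformSupport F' := fun T =>
  let ⟨R, hR⟩ := h T
  ⟨R, fun t ht x hx => hz t x (hR t ht x hx)⟩

variable (hF : ContDiffOn ℝ ((⊤ : ℕ∞) : WithTop ℕ∞) (fun z : ℝ × Plane => F z.1 z.2) spaceTime)
  (hsupp : HasUniformSupport F)
include hF hsupp

theorem integrable_slice {t : ℝ} (ht : 0 ≤ t) : Integrable (F t) :=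
  (contDiff_slice hF ht).continuous.integrable_of_hasCompactSupport (hsupp.hasCompactSupport ht)

/-- Differentiation under the integral sign. -/
theorem hasDerivAt_integral {t : ℝ} (ht : 0 < t) {F' : Plane → ℝ}
    (hF' : ∀ x, HasDerivAt (fun τ => F τ x) (F' x) t) :
    HasDerivAt (fun τ => ∫ x, F τ x) (∫ x, F' x) t := by
  obtain ⟨R, hR⟩ := hsupp (t + 1)
  obtain ⟨C, hC⟩ := exists_bound_spaceTimeDeriv hF (t + 1) R 0
  have hs : Set.Ioo 0 (t + 1) ∈ 𝓝 t := Ioo_mem_nhds ht (by linarith)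
  have hF'' : F' = fun x => spaceTimeDeriv F t x (1, 0) :=
    funext fun x => (hF' x).unique (hasDerivAt_time hF ht x)
  rw [hF'']
  refine (hasDerivAt_integral_of_dominated_loc_of_deriv_le (𝕜 := ℝ) (s := Set.Ioo 0 (t + 1))
    (F' := fun τ x => spaceTimeDeriv F τ x (1, 0))
    (bound := (Metric.closedBall (0 : Plane) R).indicator fun _ => C) hs ?_
    (integrable_slice hF hsupp ht.le) ?_ ?_ ?_ ?_).2
  · filter_upwards [hs] with τ hτ
    exact (contDiff_slice hF hτ.1.le).continuous.aestronglyMeasurable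
  · have h1 : Continuous fun x => spaceTimeDeriv F t x := by
      have := (continuousOn_spaceTimeDeriv hF).comp_continuous
        (f := fun x : Plane => (t, x)) (by fun_prop) fun _ => ⟨ht.le, trivial⟩
      exact this
    exact (h1.clm_apply continuous_const).aestronglyMeasurable
  · refine ae_of_all _ fun x τ hτ => ?_
    by_cases hx : x ∈ Metric.closedBall (0 : Plane) R
    · rw [Set.indicator_of_mem hx]
      have h1 := hC τ ⟨hτ.1.le, hτ.2.le⟩ x hx
      have h2 := (spaceTimeDeriv F τ x).le_opNorm (1, 0)
      have h3 : ‖((1 : ℝ), (0 : Plane))‖ = 1 := by simp [Prod.norm_def]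
      rw [h3, mul_one] at h2
      exact h2.trans h1
    · rw [Set.indicator_of_notMem hx]
      have h1 := hasDerivAt_time hF hτ.1 x
      have h2 : HasDerivAt (fun τ => F τ x) 0 τ := by
        refine (hasDerivAt_const τ (0 : ℝ)).congr_of_eventuallyEq ?_
        filter_upwards [Ioo_mem_nhds hτ.1 hτ.2] with σ hσ
        exact hR σ ⟨hσ.1.le, hσ.2.le⟩ x (by simpa using hx)
      rw [h1.unique h2, norm_zero]
  · exact (integrable_indicator_iff measurableSet_closedBall).2
      (integrableOn_const (measure_closedBall_lt_top).ne)
  · exact ae_of_all _ fun x τ hτ => hasDerivAt_time hF hτ.1 x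

theorem continuousOn_integral : ContinuousOn (fun t => ∫ x, F t x) (Set.Ici 0) := by
  suffices h : ∀ T, ContinuousOn (fun t => ∫ x, F t x) (Set.Icc 0 T) by
    intro t ht
    refine ((h (t + 1)) t ⟨ht, by linarith⟩).mono_of_mem_nhdsWithin ?_
    rw [← Set.Ici_inter_Iic]
    exact inter_mem_nhdsWithin _ (Iic_mem_nhds (by linarith))
  intro T
  obtain ⟨R, hR⟩ := hsupp T
  have hK : IsCompact (Set.Icc 0 T ×ˢ Metric.closedBall (0 : Plane) R) :=
    isCompact_Icc.prod (isCompact_closedBall _ _)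
  obtain ⟨C, hC⟩ := hK.exists_bound_of_continuousOn (hF.continuousOn.mono
    (Set.prod_mono (fun _ h => h.1) (Set.subset_univ _)))
  refine continuousOn_of_dominated (bound := (Metric.closedBall (0 : Plane) R).indicator fun _ => C)
    (fun t ht => (contDiff_slice hF ht.1).continuous.aestronglyMeasurable) ?_ ?_ ?_
  · refine fun t ht => ae_of_all _ fun x => ?_
    by_cases hx : x ∈ Metric.closedBall (0 : Plane) R
    · rw [Set.indicator_of_mem hx]
      exact hC (t, x) ⟨ht, hx⟩
    · rw [Set.indicator_of_notMem hx, hR t ht x (by simpa using hx), norm_zero]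
  · exact (integrable_indicator_iff measurableSet_closedBall).2
      (integrableOn_const (measure_closedBall_lt_top).ne)
  · exact ae_of_all _ fun x => hF.continuousOn.comp (f := fun t => (t, x)) (by fun_prop)
      fun t ht => ⟨ht.1, trivial⟩

end integral

/-- A divergence free field is orthogonal to gradients of compactly supported functions. -/
theorem integral_fderiv_eq_zero_of_planeDiv {w : Plane → Plane}
    (hw : ContDiff ℝ ((⊤ : ℕ∞) : WithTop ℕ∞) w)
    (hdiv : ∀ x, planeDiv w x = 0) {f : Plane → ℝ} (hf : ContDiff ℝ ((⊤ : ℕ∞) : WithTop ℕ∞) f)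
    (hc : HasCompactSupport f) : ∫ x, fderiv ℝ f x (w x) = 0 := by
  have hwd : Differentiable ℝ w := hw.differentiable (by simp)
  have hfd : Differentiable ℝ f := hf.differentiable (by simp)
  have hwc : Continuous (fderiv ℝ w) := hw.continuous_fderiv (by simp)
  have hfc : Continuous (fderiv ℝ f) := hf.continuous_fderiv (by simp)
  have pr : ∀ (i : Fin 2) (x v : Plane), fderiv ℝ (fun y => w y i) x v = fderiv ℝ w x v i := by
    intro i x v
    have := ((EuclideanSpace.proj (𝕜 := ℝ) i).hasFDerivAt.comp x (hwd x).hasFDerivAt).fderiv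
    have e : (fun y => w y i) = (EuclideanSpace.proj (𝕜 := ℝ) i : Plane →L[ℝ] ℝ) ∘ w := rfl
    rw [e, this]; rfl
  have i1 : ∀ i : Fin 2, Integrable
      fun x => fderiv ℝ (fun y => w y i) x (EuclideanSpace.single i 1) * f x := by
    intro i
    simp only [pr]
    refine Continuous.integrable_of_hasCompactSupport ?_ hc.mul_left
    have := hf.continuous
    fun_prop
  have i2 : ∀ i : Fin 2, Integrable
      fun x => w x i * fderiv ℝ f x (EuclideanSpace.single i 1) := by
    intro i
    refine Continuous.integrable_of_hasCompactSupport ?_ (hc.fderiv_apply (𝕜 := ℝ) _).mul_left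
    have := hw.continuous
    fun_prop
  have i3 : ∀ i : Fin 2, Integrable fun x => w x i * f x := by
    intro i
    refine Continuous.integrable_of_hasCompactSupport ?_ hc.mul_left
    have := hw.continuous
    have := hf.continuous
    fun_prop
  have key : ∀ i : Fin 2, ∫ x, w x i * fderiv ℝ f x (EuclideanSpace.single i 1) =
      -∫ x, fderiv ℝ (fun y => w y i) x (EuclideanSpace.single i 1) * f x := fun i =>
    integral_mul_fderiv_eq_neg_fderiv_mul_of_integrable (i1 i) (i2 i) (i3 i)
      (fun x _ => by fun_prop) fun x _ => hfd x
  have e1 : ∀ x, fderiv ℝ f x (w x) =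
      ∑ i : Fin 2, w x i * fderiv ℝ f x (EuclideanSpace.single i 1) := by
    intro x
    conv_lhs => rw [← (EuclideanSpace.basisFun (Fin 2) ℝ).sum_repr (w x)]
    simp
  simp only [e1]
  rw [integral_finsetSum _ fun i _ => i2 i, Finset.sum_congr rfl fun i _ => key i,
    Finset.sum_neg_distrib, ← integral_finsetSum _ fun i _ => i1 i]
  simp only [pr, ← Finset.sum_mul]
  have : ∀ x, (∑ i : Fin 2, fderiv ℝ w x (EuclideanSpace.single i 1) i) = 0 := hdiv
  simp [this]

/-! ### Characteristics and conserved quantities -/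

theorem inner_gradient_eq (f : Plane → ℝ) (x v : Plane) :
    inner ℝ v (gradient f x) = fderiv ℝ f x v := by
  rw [real_inner_comm]
  simp [gradient]

/-- A continuous function on `[0, ∞)` whose derivative vanishes for positive times is constant. -/
theorem eq_of_hasDerivAt_zero {f : ℝ → ℝ} (hc : ContinuousOn f (Set.Ici 0))
    (hd : ∀ t, 0 < t → HasDerivAt f 0 t) {t : ℝ} (ht : 0 ≤ t) : f t = f 0 := by
  have hd' : DifferentiableOn ℝ f (interior (Set.Ici 0)) := by
    rw [interior_Ici]
    exact fun s hs => (hd s hs).differentiableAt.differentiableWithinAt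
  refine le_antisymm ?_ ?_
  · refine antitoneOn_of_deriv_nonpos (convex_Ici 0) hc hd' (fun s hs => ?_) Set.self_mem_Ici ht ht
    rw [interior_Ici] at hs
    rw [(hd s hs).deriv]
  · refine monotoneOn_of_deriv_nonneg (convex_Ici 0) hc hd' (fun s hs => ?_) Set.self_mem_Ici ht ht
    rw [interior_Ici] at hs
    rw [(hd s hs).deriv]

namespace IsGlobalSmoothIPMSolution

variable {ρ₀ : Plane → ℝ} {ρ : ℝ → Plane → ℝ} {u : ℝ → Plane → Plane} {p : ℝ → Plane → ℝ}

section basic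

variable (h : IsGlobalSmoothIPMSolution ρ₀ ρ u p)
include h

theorem material_derivative {t : ℝ} (ht : 0 ≤ t) (x : Plane) :
    spaceTimeDeriv ρ t x (1, u t x) = 0 := by
  have h1 := h.transport t ht x
  rw [inner_gradient_eq, derivWithin_time h.smooth_density ht,
    fderiv_slice h.smooth_density ht, ← map_add] at h1
  simpa using h1

theorem hasDerivAt_density {t : ℝ} (ht : 0 < t) (x : Plane) :
    HasDerivAt (fun τ => ρ τ x) (-fderiv ℝ (ρ t) x (u t x)) t := by
  have h1 := hasDerivAt_time h.smooth_density ht x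
  have h2 := h.transport t ht.le x
  rw [inner_gradient_eq, derivWithin_time h.smooth_density ht.le] at h2
  rwa [eq_neg_of_add_eq_zero_left h2] at h1

/-- Every point is reached, at every time, by a characteristic which starts at time zero: as the
velocity is bounded by some `M` up to time `t`, the Picard-Lindelöf theorem on the ball of radius
`M t` gives a solution on the whole of `[0, t]`. -/
theorem exists_characteristic {t : ℝ} (ht : 0 ≤ t) (x : Plane) :
    ∃ X : ℝ → Plane, X t = x ∧
      ∀ τ ∈ Set.Icc 0 t, HasDerivWithinAt X (u τ (X τ)) (Set.Icc 0 t) τ := by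
  obtain ⟨M, hM⟩ := h.bounded_velocity t
  have hM0 : 0 ≤ M := (norm_nonneg _).trans (hM 0 ⟨le_rfl, ht⟩ 0)
  obtain ⟨K, hK⟩ := exists_lipschitzOnWith h.smooth_velocity t (M * t) x
  have hPL : IsPicardLindelof u (⟨t, ht, le_rfl⟩ : Set.Icc 0 t) x
      (⟨M * t, mul_nonneg hM0 ht⟩ : NNReal) 0 ⟨M, hM0⟩ K :=
    { lipschitzOnWith := hK
      continuousOn := fun y _ => h.smooth_velocity.continuousOn.comp (f := fun τ => (τ, y))
        (by fun_prop) fun τ hτ => ⟨hτ.1, trivial⟩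
      norm_le := fun τ hτ y _ => hM τ hτ y
      mul_max_le := by simp [ht]; exact le_rfl }
  exact hPL.exists_eq_forall_mem_Icc_hasDerivWithinAt₀

theorem density_eq_of_characteristic {t : ℝ} (ht : 0 ≤ t) {X : ℝ → Plane}
    (hX : ∀ τ ∈ Set.Icc 0 t, HasDerivWithinAt X (u τ (X τ)) (Set.Icc 0 t) τ) :
    ρ t (X t) = ρ₀ (X 0) := by
  have hd : ∀ τ ∈ Set.Icc 0 t,
      HasDerivWithinAt (fun τ => ρ τ (X τ)) 0 (Set.Icc 0 t) τ := fun τ hτ => by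
    have := hasDerivWithinAt_along h.smooth_density (fun _ hs => hs.1) hτ (hX τ hτ)
    rwa [h.material_derivative hτ.1] at this
  have h1 := (convex_Icc 0 t).norm_image_sub_le_of_norm_hasDerivWithin_le (C := 0) hd
    (fun _ _ => by simp) (Set.left_mem_Icc.2 ht) (Set.right_mem_Icc.2 ht)
  rw [← h.initial]
  simpa [sub_eq_zero] using h1

theorem hasUniformSupport (hc : HasCompactSupport ρ₀) : HasUniformSupport ρ := by
  intro T
  obtain ⟨R, hR⟩ := hc.isCompact.isBounded.subset_closedBall 0
  obtain ⟨M, hM⟩ := h.bounded_velocity T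
  refine ⟨R + M * T, fun t ht x hx => ?_⟩
  have hM0 : 0 ≤ M := (norm_nonneg _).trans (hM t ht 0)
  obtain ⟨X, rfl, hX⟩ := h.exists_characteristic ht.1 x
  rw [h.density_eq_of_characteristic ht.1 hX]
  by_contra hne
  have h1 : ‖X 0‖ ≤ R := by simpa using hR (subset_tsupport _ hne)
  have h2 := norm_image_sub_le_of_norm_deriv_le_segment' hX
    (fun τ hτ => hM τ ⟨hτ.1, hτ.2.le.trans ht.2⟩ _) t (Set.right_mem_Icc.2 ht.1)
  have h3 := norm_sub_norm_le (X t) (X 0)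
  have h4 : M * (t - 0) ≤ M * T := by rw [sub_zero]; exact mul_le_mul_of_nonneg_left ht.2 hM0
  linarith

theorem curl_velocity {t : ℝ} (ht : 0 ≤ t) (x : Plane) :
    fderiv ℝ (u t) x (EuclideanSpace.single 0 1) 1 -
      fderiv ℝ (u t) x (EuclideanSpace.single 1 1) 0 =
      -fderiv ℝ (ρ t) x (EuclideanSpace.single 0 1) :=
  curl_of_darcy ((contDiff_slice h.smooth_density ht).differentiable (by simp))
    (h.smooth_pressure t ht) (h.darcy t ht)
    ((contDiff_slice h.smooth_velocity ht).differentiable (by simp)) x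

theorem velocity_eq {t : ℝ} (ht : 0 ≤ t) (S : 𝓢(Plane, ℂ)) (hS : ∀ x, S x = (ρ t x : ℂ))
    (x : Plane) : (u t x 0 : ℂ) - Complex.I * (u t x 1 : ℂ) =
      𝓕⁻ (fun η => velocitySymbol η * 𝓕 S η) x :=
  biotSavart S hS ((contDiff_slice h.smooth_density ht).differentiable (by simp))
    ((contDiff_slice h.smooth_velocity ht).differentiable (by simp))
    (h.velocity_vanishes t ht) (h.incompressible t ht) (h.curl_velocity ht) x

section weighted

variable (hc : HasCompactSupport ρ₀) {a : Plane → ℝ} {β : ℝ → ℝ}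
  (ha : ContDiff ℝ ((⊤ : ℕ∞) : WithTop ℕ∞) a) (hβ : ContDiff ℝ ((⊤ : ℕ∞) : WithTop ℕ∞) β)
  (hβ0 : β 0 = 0)
include hc hβ0

theorem hasUniformSupport_weighted : HasUniformSupport fun t x => a x * β (ρ t x) :=
  (h.hasUniformSupport hc).mono fun t x hx => by simp [hx, hβ0]

omit hc hβ0 in
include ha hβ in
theorem contDiffOn_weighted : ContDiffOn ℝ ((⊤ : ℕ∞) : WithTop ℕ∞)
    (fun z : ℝ × Plane => a z.2 * β (ρ z.1 z.2)) spaceTime :=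
  (ha.comp contDiff_snd).contDiffOn.mul (hβ.comp_contDiffOn h.smooth_density)

include ha hβ

/-- Weak form of the transport equation for a function `β ρ` of the density. -/
theorem hasDerivAt_integral_weighted {t : ℝ} (ht : 0 < t) :
    HasDerivAt (fun τ => ∫ x, a x * β (ρ τ x)) (∫ x, fderiv ℝ a x (u t x) * β (ρ t x)) t := by
  have hρ := contDiff_slice h.smooth_density ht.le
  have hu := contDiff_slice h.smooth_velocity ht.le
  have hρd : Differentiable ℝ (ρ t) := hρ.differentiable (by simp)
  have had : Differentiable ℝ a := ha.differentiable (by simp)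
  have hβd : Differentiable ℝ β := hβ.differentiable (by simp)
  have hs := (h.hasUniformSupport_weighted hc (a := a) hβ0).hasCompactSupport ht.le
  have h1 := hasDerivAt_integral (h.contDiffOn_weighted ha hβ)
    (h.hasUniformSupport_weighted hc hβ0) ht
    (F' := fun x => a x * (deriv β (ρ t x) * -fderiv ℝ (ρ t) x (u t x)))
    fun x => ((hβd _).hasDerivAt.comp t (h.hasDerivAt_density ht x)).const_mul (a x)
  have h2 := integral_fderiv_eq_zero_of_planeDiv hu (h.incompressible t ht.le)
    (ha.mul (hβ.comp hρ)) hs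
  have hfd : ∀ x, fderiv ℝ (fun x => a x * β (ρ t x)) x (u t x) =
      fderiv ℝ a x (u t x) * β (ρ t x) + a x * (deriv β (ρ t x) * fderiv ℝ (ρ t) x (u t x)) := by
    intro x
    have : HasFDerivAt (fun x => a x * β (ρ t x)) _ x :=
      (had x).hasFDerivAt.mul ((hβd (ρ t x)).hasDerivAt.comp_hasFDerivAt x (hρd x).hasFDerivAt)
    rw [this.fderiv]
    simp
    ring
  have hβs : HasCompactSupport fun x => β (ρ t x) :=
    ((h.hasUniformSupport hc).hasCompactSupport ht.le).comp_left hβ0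
  have c1 : Continuous (fderiv ℝ a) := ha.continuous_fderiv (by simp)
  have c2 : Continuous (fderiv ℝ (ρ t)) := hρ.continuous_fderiv (by simp)
  have c3 : Continuous (deriv β) := hβ.continuous_deriv (by simp)
  have c4 := hu.continuous
  have c5 := hρ.continuous
  have c6 := hβ.continuous
  have c7 := ha.continuous
  have i1 : Integrable fun x => fderiv ℝ a x (u t x) * β (ρ t x) :=
    Continuous.integrable_of_hasCompactSupport (by fun_prop) hβs.mul_left
  have i2 : Integrable fun x => a x * (deriv β (ρ t x) * fderiv ℝ (ρ t) x (u t x)) := by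
    refine Continuous.integrable_of_hasCompactSupport (by fun_prop)
      (HasCompactSupport.mul_left (HasCompactSupport.mul_left ?_))
    refine HasCompactSupport.intro' (K := tsupport (ρ t))
      ((h.hasUniformSupport hc).hasCompactSupport ht.le).isCompact (isClosed_tsupport _) ?_
    intro x hx
    have : fderiv ℝ (ρ t) x = 0 :=
      Function.notMem_support.1 fun hx' => hx (support_fderiv_subset ℝ hx')
    simp [this]
  have h3 : ∫ x, (fderiv ℝ a x (u t x) * β (ρ t x) +
      a x * (deriv β (ρ t x) * fderiv ℝ (ρ t) x (u t x))) = 0 := by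
    rw [← h2]; exact integral_congr_ae (ae_of_all _ fun x => (hfd x).symm)
  rw [integral_add i1 i2] at h3
  convert h1 using 1
  simp only [mul_neg, integral_neg]
  linarith

theorem continuousOn_integral_weighted :
    ContinuousOn (fun t => ∫ x, a x * β (ρ t x)) (Set.Ici 0) :=
  continuousOn_integral (h.contDiffOn_weighted ha hβ) (h.hasUniformSupport_weighted hc hβ0)

omit ha in
theorem integral_comp_density {t : ℝ} (ht : 0 ≤ t) :
    ∫ x, β (ρ t x) = ∫ x, β (ρ₀ x) := by
  have h1 := h.continuousOn_integral_weighted hc (a := fun _ => 1) contDiff_const hβ hβ0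
  have h2 := fun t ht =>
    h.hasDerivAt_integral_weighted hc (a := fun _ => 1) contDiff_const hβ hβ0 (t := t) ht
  simp only [one_mul, fderiv_const_apply, zero_apply, zero_mul, integral_zero] at h1 h2
  rw [eq_of_hasDerivAt_zero h1 h2 ht]
  simp only [h.initial]

end weighted

theorem integral_sq_density (hc : HasCompactSupport ρ₀) {t : ℝ} (ht : 0 ≤ t) :
    ∫ x, ρ t x ^ 2 = ∫ x, ρ₀ x ^ 2 :=
  h.integral_comp_density hc (β := fun r => r ^ 2) (contDiff_id.pow 2) (by simp) ht

/-- The `L¹` norm of the density does not grow: apply conservation of `∫ β(ρ)` to the smooth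
approximations `β(r) = √(r² + ε²) - ε` of the absolute value. -/
theorem integral_abs_density_le (hc : HasCompactSupport ρ₀) {t : ℝ} (ht : 0 ≤ t) :
    ∫ x, |ρ t x| ≤ ∫ x, |ρ₀ x| := by
  obtain ⟨R, hR⟩ := h.hasUniformSupport hc t
  have hρ := contDiff_slice h.smooth_density ht
  have hρ0 : ContDiff ℝ ((⊤ : ℕ∞) : WithTop ℕ∞) ρ₀ := by
    rw [show ρ₀ = ρ 0 from funext fun x => (h.initial x).symm]
    exact contDiff_slice h.smooth_density le_rfl
  have hs := (h.hasUniformSupport hc).hasCompactSupport ht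
  set V : ℝ := volume.real (Metric.closedBall (0 : Plane) R) with hV
  have hV0 : 0 ≤ V := measureReal_nonneg
  have key : ∀ ε : ℝ, 0 < ε → ∫ x, |ρ t x| ≤ (∫ x, |ρ₀ x|) + ε * V := by
    intro ε hε
    let β : ℝ → ℝ := fun r => √(r ^ 2 + ε ^ 2) - ε
    have hβ : ContDiff ℝ ((⊤ : ℕ∞) : WithTop ℕ∞) β :=
      (((contDiff_id.pow 2).add contDiff_const).sqrt fun r => by positivity).sub contDiff_const
    have hβ0 : β 0 = 0 := by simp [β, Real.sqrt_sq hε.le]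
    have hβ1 : ∀ r, β r ≤ |r| := by
      intro r
      have : √(r ^ 2 + ε ^ 2) ≤ |r| + ε := by
        rw [Real.sqrt_le_left (by positivity)]
        nlinarith [sq_abs r, abs_nonneg r]
      simp only [β]; linarith
    have hβ2 : ∀ r, |r| ≤ β r + ε := by
      intro r
      have : |r| ≤ √(r ^ 2 + ε ^ 2) := Real.abs_le_sqrt (by nlinarith)
      simp only [β]; linarith
    have i1 : Integrable fun x => β (ρ t x) :=
      (hβ.continuous.comp hρ.continuous).integrable_of_hasCompactSupport (hs.comp_left hβ0)
    have i2 : Integrable fun x => β (ρ₀ x) :=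
      (hβ.continuous.comp hρ0.continuous).integrable_of_hasCompactSupport (hc.comp_left hβ0)
    have i3 : Integrable ((Metric.closedBall (0 : Plane) R).indicator fun _ => ε) :=
      (integrable_indicator_iff measurableSet_closedBall).2
        (integrableOn_const (measure_closedBall_lt_top).ne)
    have i4 : Integrable fun x => |ρ t x| :=
      hρ.continuous.abs.integrable_of_hasCompactSupport (hs.comp_left abs_zero)
    have i5 : Integrable fun x => |ρ₀ x| :=
      hρ0.continuous.abs.integrable_of_hasCompactSupport (hc.comp_left abs_zero)
    calc ∫ x, |ρ t x|
        ≤ ∫ x, (β (ρ t x) + (Metric.closedBall (0 : Plane) R).indicator (fun _ => ε) x) := by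
          refine integral_mono i4 (i1.add i3) fun x => ?_
          by_cases hx : x ∈ Metric.closedBall (0 : Plane) R
          · simpa [Set.indicator_of_mem hx] using hβ2 (ρ t x)
          · simp [Set.indicator_of_notMem hx, hR t ⟨ht, le_rfl⟩ x (by simpa using hx), hβ0]
      _ = (∫ x, β (ρ₀ x)) + ε * V := by
          rw [integral_add i1 i3, h.integral_comp_density hc hβ hβ0 ht,
            integral_indicator measurableSet_closedBall, setIntegral_const, smul_eq_mul, mul_comm]
      _ ≤ (∫ x, |ρ₀ x|) + ε * V := by
          gcongr
          exact fun x => hβ1 _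
  refine le_of_forall_pos_le_add fun ε hε => (key (ε / (V + 1)) (by positivity)).trans ?_
  gcongr
  rw [div_mul_eq_mul_div, div_le_iff₀ (by positivity)]
  nlinarith

end basic

end IsGlobalSmoothIPMSolution

/-! ### Uniqueness, odd symmetry and the potential energy -/

namespace IsGlobalSmoothIPMSolution

section uniqueness

variable {ρ₀ : Plane → ℝ} {ρ ρ' : ℝ → Plane → ℝ} {u u' : ℝ → Plane → Plane}
  {p p' : ℝ → Plane → ℝ}
  (h : IsGlobalSmoothIPMSolution ρ₀ ρ u p) (h' : IsGlobalSmoothIPMSolution ρ₀ ρ' u' p')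
  (hc : HasCompactSupport ρ₀)
include h h'

theorem velocity_sub_eq {t : ℝ} (ht : 0 ≤ t) (S : 𝓢(Plane, ℂ))
    (hS : ∀ x, S x = ((ρ t x - ρ' t x : ℝ) : ℂ)) (x : Plane) :
    (((u t x - u' t x) 0 : ℝ) : ℂ) - Complex.I * (((u t x - u' t x) 1 : ℝ) : ℂ) =
      𝓕⁻ (fun η => velocitySymbol η * 𝓕 S η) x := by
  have d1 : Differentiable ℝ (u t) :=
    (contDiff_slice h.smooth_velocity ht).differentiable (by simp)
  have d2 : Differentiable ℝ (u' t) :=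
    (contDiff_slice h'.smooth_velocity ht).differentiable (by simp)
  have d3 : Differentiable ℝ (ρ t) :=
    (contDiff_slice h.smooth_density ht).differentiable (by simp)
  have d4 : Differentiable ℝ (ρ' t) :=
    (contDiff_slice h'.smooth_density ht).differentiable (by simp)
  have e1 : ∀ y, fderiv ℝ (fun x => u t x - u' t x) y = fderiv ℝ (u t) y - fderiv ℝ (u' t) y :=
    fun y => fderiv_fun_sub (d1 y) (d2 y)
  have e2 : ∀ y, fderiv ℝ (fun x => ρ t x - ρ' t x) y = fderiv ℝ (ρ t) y - fderiv ℝ (ρ' t) y :=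
    fun y => fderiv_fun_sub (d3 y) (d4 y)
  refine biotSavart (θ := fun x => ρ t x - ρ' t x) (w := fun x => u t x - u' t x) S hS
    (d3.sub d4) (d1.sub d2) ?_ ?_ ?_ x
  · simpa using (h.velocity_vanishes t ht).sub (h'.velocity_vanishes t ht)
  · intro y
    have a1 := h.incompressible t ht y
    have a2 := h'.incompressible t ht y
    simp only [planeDiv, Fin.sum_univ_two] at a1 a2 ⊢
    simp only [e1, sub_apply, PiLp.sub_apply]
    linarith
  · intro y
    have a1 := h.curl_velocity ht y
    have a2 := h'.curl_velocity ht y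
    simp only [e1, e2, sub_apply, PiLp.sub_apply]
    linarith

include hc

/-- Smooth solutions with the same initial density have the same density: the square of the `L²`
norm of the difference satisfies a Gronwall inequality, with a constant which depends on the
gradient of one of the two densities. -/
theorem density_unique {t : ℝ} (ht : 0 ≤ t) (x : Plane) : ρ t x = ρ' t x := by
  let D : ℝ → ℝ := fun τ => ∫ x, (ρ τ x - ρ' τ x) ^ 2
  have hθ : ContDiffOn ℝ ((⊤ : ℕ∞) : WithTop ℕ∞)
      (fun z : ℝ × Plane => (ρ z.1 z.2 - ρ' z.1 z.2)) spaceTime :=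
    h.smooth_density.sub h'.smooth_density
  have hsθ : HasUniformSupport fun τ x => ρ τ x - ρ' τ x := by
    intro T
    obtain ⟨R, hR⟩ := h.hasUniformSupport hc T
    obtain ⟨R', hR'⟩ := h'.hasUniformSupport hc T
    refine ⟨max R R', fun τ hτ y hy => ?_⟩
    simp only [hR τ hτ y ((le_max_left _ _).trans_lt hy),
      hR' τ hτ y ((le_max_right _ _).trans_lt hy), sub_zero]
  have hs : HasUniformSupport fun τ x => (ρ τ x - ρ' τ x) ^ 2 :=
    hsθ.mono fun τ y hy => by simp [hy]
  have hD : ContinuousOn D (Set.Ici 0) := continuousOn_integral (hθ.pow 2) hs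
  obtain ⟨R, hR⟩ : ∃ R, ∀ τ ∈ Set.Icc 0 t, ∀ y, R < ‖y‖ → ρ τ y - ρ' τ y = 0 := hsθ t
  obtain ⟨C, hC⟩ := exists_bound_spaceTimeDeriv h'.smooth_density t R 0
  have key : ∀ τ ∈ Set.Ioo 0 t, ∃ D', HasDerivAt D D' τ ∧ D' ≤ (1 + C ^ 2) * D τ := by
    intro τ hτ
    have hτ0 := hτ.1.le
    have s1 := contDiff_slice (F := fun τ y => ρ τ y - ρ' τ y) hθ hτ0
    have s2 := contDiff_slice h'.smooth_density hτ0
    have s3 := contDiff_slice h.smooth_velocity hτ0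
    have s4 := contDiff_slice h'.smooth_velocity hτ0
    have s5 := contDiff_slice h.smooth_density hτ0
    have d1 : Differentiable ℝ (ρ τ) := s5.differentiable (by simp)
    have d2 : Differentiable ℝ (ρ' τ) := s2.differentiable (by simp)
    have cs := hsθ.hasCompactSupport hτ0
    have hgrad : ContDiff ℝ ((⊤ : ℕ∞) : WithTop ℕ∞) (gradient (ρ' τ)) :=
      (InnerProductSpace.toDual ℝ Plane).symm.contDiff.comp (s2.fderiv_right (by simp))
    let H : Plane → Plane := fun y => (ρ τ y - ρ' τ y) • gradient (ρ' τ) y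
    have hH : ContDiff ℝ ((⊤ : ℕ∞) : WithTop ℕ∞) H := s1.smul hgrad
    have hHs : HasCompactSupport H := cs.smul_right
    let S := schwartzOfReal (fun y => ρ τ y - ρ' τ y) s1 cs
    have hb := abs_integral_inner_velocity_le S (θ := fun y => ρ τ y - ρ' τ y) (fun _ => rfl)
      (s3.continuous.sub s4.continuous) (h.velocity_sub_eq h' hτ0 S fun _ => rfl) hH hHs
    have hH2 : ∫ y, ‖H y‖ ^ 2 ≤ C ^ 2 * D τ := by
      rw [← integral_const_mul]
      refine integral_mono ?_ ((integrable_slice (hθ.pow 2) hs hτ0).const_mul _) fun y => ?_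
      · refine Continuous.integrable_of_hasCompactSupport (hH.continuous.norm.pow 2) ?_
        exact hHs.comp_left (g := fun v => ‖v‖ ^ 2) (by simp)
      · simp only [H, norm_smul, mul_pow, Real.norm_eq_abs, sq_abs]
        by_cases hy : R < ‖y‖
        · rw [hR τ ⟨hτ0, hτ.2.le⟩ y hy]; simp
        · have b1 := hC τ ⟨hτ0, hτ.2.le⟩ y (by simpa using hy)
          have b2 : ‖gradient (ρ' τ) y‖ ≤ C := by
            rw [gradient, LinearIsometryEquiv.norm_map]
            refine ContinuousLinearMap.opNorm_le_bound _ ((norm_nonneg _).trans b1) fun v => ?_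
            rw [fderiv_slice h'.smooth_density hτ0]
            have := (spaceTimeDeriv ρ' τ y).le_opNorm (0, v)
            have e : ‖((0 : ℝ), v)‖ = ‖v‖ := by simp [Prod.norm_def]
            rw [e] at this
            exact this.trans (by gcongr)
          rw [mul_comm]
          gcongr
    -- With `θ = ρ - ρ'`, the equations give `∂ₜ(θ²) = -u·∇(θ²) - 2 (u - u')·(θ ∇ρ')`; the first
    -- term integrates to zero.
    have hd : ∀ y, HasDerivAt (fun σ => (ρ σ y - ρ' σ y) ^ 2)
        (-fderiv ℝ (fun y => (ρ τ y - ρ' τ y) ^ 2) y (u τ y) -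
          2 * inner ℝ (u τ y - u' τ y) (H y)) τ := by
      intro y
      have := ((h.hasDerivAt_density hτ.1 y).sub (h'.hasDerivAt_density hτ.1 y)).pow 2
      have e1 : HasFDerivAt (fun y => (ρ τ y - ρ' τ y) ^ 2) _ y :=
        ((d1 y).hasFDerivAt.sub (d2 y).hasFDerivAt).pow 2
      refine HasDerivAt.congr_deriv this ?_
      rw [e1.fderiv]
      simp only [H, inner_smul_right, inner_gradient_eq, map_sub]
      simp
      ring
    refine ⟨_, hasDerivAt_integral (hθ.pow 2) hs hτ.1 hd, ?_⟩
    have z := integral_fderiv_eq_zero_of_planeDiv s3 (h.incompressible τ hτ0) (s1.pow 2)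
      (hs.hasCompactSupport hτ0)
    have i1 : Integrable fun y => fderiv ℝ (fun y => (ρ τ y - ρ' τ y) ^ 2) y (u τ y) := by
      have c1 : Continuous (fderiv ℝ fun y => (ρ τ y - ρ' τ y) ^ 2) :=
        (s1.pow 2).continuous_fderiv (by simp)
      refine Continuous.integrable_of_hasCompactSupport (c1.clm_apply s3.continuous) ?_
      refine HasCompactSupport.mono' ((hs.hasCompactSupport hτ0).fderiv (𝕜 := ℝ)) ?_
      intro y hy
      refine subset_tsupport _ fun hy' => hy ?_
      simp [hy']
    have i2 : Integrable fun y => (inner ℝ (u τ y - u' τ y) (H y) : ℝ) := by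
      refine Continuous.integrable_of_hasCompactSupport
        ((s3.continuous.sub s4.continuous).inner hH.continuous) ?_
      refine hHs.mono fun y hy hy' => hy ?_
      simp [hy']
    rw [integral_sub (f := fun y => -fderiv ℝ (fun y => (ρ τ y - ρ' τ y) ^ 2) y (u τ y)) i1.neg
      (i2.const_mul 2), integral_neg, integral_const_mul, z]
    have := neg_abs_le (∫ y, (inner ℝ (u τ y - u' τ y) (H y) : ℝ))
    simp only [Pi.sub_apply] at hb
    have e : D τ = ∫ y, (ρ τ y - ρ' τ y) ^ 2 := rfl
    rw [← e] at hb
    linarith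
  -- Gronwall: `exp (-(1 + C²) τ) D τ` is nonincreasing and vanishes at time zero.
  have hanti : AntitoneOn (fun τ => Real.exp (-(1 + C ^ 2) * τ) * D τ) (Set.Icc 0 t) := by
    have hd : ∀ τ ∈ Set.Ioo 0 t, ∃ E', HasDerivAt
        (fun τ => Real.exp (-(1 + C ^ 2) * τ) * D τ) E' τ ∧ E' ≤ 0 := by
      intro τ hτ
      obtain ⟨D', h1, h2⟩ := key τ hτ
      refine ⟨_, (((hasDerivAt_id τ).const_mul (-(1 + C ^ 2))).exp).mul h1, ?_⟩
      have := Real.exp_pos (-(1 + C ^ 2) * τ)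
      simp only [id]
      nlinarith
    refine antitoneOn_of_deriv_nonpos (convex_Icc 0 t) ?_ ?_ ?_
    · exact (by fun_prop : Continuous fun τ => Real.exp (-(1 + C ^ 2) * τ)).continuousOn.mul
        (hD.mono Set.Icc_subset_Ici_self)
    · rw [interior_Icc]
      intro τ hτ
      obtain ⟨E', h1, -⟩ := hd τ hτ
      exact h1.differentiableAt.differentiableWithinAt
    · rw [interior_Icc]
      intro τ hτ
      obtain ⟨E', h1, h2⟩ := hd τ hτ
      rwa [h1.deriv]
  have hD0 : D 0 = 0 := by simp [D, h.initial, h'.initial]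
  have h1 := hanti (Set.left_mem_Icc.2 ht) (Set.right_mem_Icc.2 ht) ht
  simp only [hD0, mul_zero] at h1
  have h2 : 0 ≤ D t := integral_nonneg fun y => sq_nonneg _
  have h3 : D t = 0 := by
    have := Real.exp_pos (-(1 + C ^ 2) * t)
    nlinarith
  have h4 := (integral_eq_zero_iff_of_nonneg (fun y => sq_nonneg _)
    (integrable_slice (hθ.pow 2) hs ht)).1 h3
  have h5 := (Continuous.ae_eq_iff_eq volume
    (contDiff_slice (F := fun τ y => (ρ τ y - ρ' τ y) ^ 2) (hθ.pow 2) ht).continuous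
    continuous_zero).1 h4
  have h6 := congrFun h5 x
  simpa [sub_eq_zero] using h6

/-- Smooth solutions with the same initial density have the same velocity. -/
theorem velocity_unique {t : ℝ} (ht : 0 ≤ t) : u t = u' t := by
  ext x i
  let S := schwartzOfReal (ρ t) (contDiff_slice h.smooth_density ht)
    ((h.hasUniformSupport hc).hasCompactSupport ht)
  have h1 := h.velocity_eq ht S (fun _ => rfl) x
  have h2 := h'.velocity_eq ht S (fun y => by rw [← h.density_unique h' hc ht]; rfl) x
  rw [← h2] at h1
  have hr := congrArg Complex.re h1
  have hi := congrArg Complex.im h1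
  simp at hr hi
  fin_cases i
  · exact hr
  · exact hi

end uniqueness

end IsGlobalSmoothIPMSolution

/-- The reflection `(x₁, x₂) ↦ (x₁, -x₂)`. -/
noncomputable def reflect : Plane ≃ₗᵢ[ℝ] Plane :=
  LinearIsometryEquiv.piLpCongrRight 2 fun i : Fin 2 =>
    if i = 0 then LinearIsometryEquiv.refl ℝ ℝ else LinearIsometryEquiv.neg ℝ

@[simp] theorem reflect_apply_zero (x : Plane) : reflect x 0 = x 0 := by simp [reflect]

@[simp] theorem reflect_apply_one (x : Plane) : reflect x 1 = -x 1 := by simp [reflect]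

@[simp] theorem reflect_reflect (x : Plane) : reflect (reflect x) = x := by
  ext i; fin_cases i <;> simp

theorem reflect_single_zero :
    reflect (EuclideanSpace.single 0 1) = EuclideanSpace.single 0 1 := by
  ext i; fin_cases i <;> simp

theorem reflect_single_one :
    reflect (EuclideanSpace.single 1 1) = -EuclideanSpace.single 1 1 := by
  ext i; fin_cases i <;> simp

theorem fderiv_comp_reflect {G : Type*} [NormedAddCommGroup G] [NormedSpace ℝ G] {f : Plane → G}
    (hf : Differentiable ℝ f) (x v : Plane) :
    fderiv ℝ (fun y => f (reflect y)) x v = fderiv ℝ f (reflect x) (reflect v) := by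
  have : HasFDerivAt (fun y => f (reflect y)) _ x :=
    (hf (reflect x)).hasFDerivAt.comp x reflect.toContinuousLinearEquiv.hasFDerivAt
  rw [this.fderiv]
  rfl

theorem gradient_comp_reflect {f : Plane → ℝ} (hf : Differentiable ℝ f) (x : Plane) :
    gradient (fun y => f (reflect y)) x = reflect (gradient f (reflect x)) := by
  ext i
  fin_cases i
  · simp [gradient_apply, fderiv_comp_reflect hf, reflect_single_zero]
  · simp [gradient_apply, fderiv_comp_reflect hf, reflect_single_one]

namespace IsGlobalSmoothIPMSolution

variable {ρ₀ : Plane → ℝ} {ρ : ℝ → Plane → ℝ} {u : ℝ → Plane → Plane} {p : ℝ → Plane → ℝ}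
  (h : IsGlobalSmoothIPMSolution ρ₀ ρ u p)
include h

/-- The equation is invariant under the reflection `x₂ ↦ -x₂` combined with `ρ ↦ -ρ`. -/
theorem reflected (hodd : ∀ x, ρ₀ (reflect x) = -ρ₀ x) :
    IsGlobalSmoothIPMSolution ρ₀ (fun t x => -ρ t (reflect x))
      (fun t x => reflect (u t (reflect x))) fun t x => p t (reflect x) where
  smooth_density := by
    have hg : ContDiff ℝ ((⊤ : ℕ∞) : WithTop ℕ∞) fun z : ℝ × Plane => (z.1, reflect z.2) :=
      contDiff_fst.prodMk (reflect.contDiff.comp contDiff_snd)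
    exact (h.smooth_density.comp hg.contDiffOn fun z hz => ⟨hz.1, trivial⟩).neg
  smooth_velocity := by
    have hg : ContDiff ℝ ((⊤ : ℕ∞) : WithTop ℕ∞) fun z : ℝ × Plane => (z.1, reflect z.2) :=
      contDiff_fst.prodMk (reflect.contDiff.comp contDiff_snd)
    exact reflect.contDiff.comp_contDiffOn
      (h.smooth_velocity.comp hg.contDiffOn fun z hz => ⟨hz.1, trivial⟩)
  smooth_pressure := fun t ht => (h.smooth_pressure t ht).comp reflect.contDiff
  bounded_velocity := fun T => by
    obtain ⟨M, hM⟩ := h.bounded_velocity T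
    exact ⟨M, fun t ht x => by simpa using hM t ht (reflect x)⟩
  velocity_vanishes := fun t ht => by
    have h1 := (h.velocity_vanishes t ht).comp
      reflect.toHomeomorph.isClosedEmbedding.tendsto_cocompact
    have h2 := (reflect.continuous.tendsto 0).comp h1
    rw [map_zero] at h2
    exact h2
  initial := fun x => by simp only [h.initial, hodd, neg_neg]
  transport := fun t ht x => by
    have d : Differentiable ℝ (ρ t) :=
      (contDiff_slice h.smooth_density ht).differentiable (by simp)
    have h1 := h.transport t ht (reflect x)
    rw [inner_gradient_eq] at h1 ⊢
    rw [derivWithin.fun_neg, fderiv_fun_neg, neg_apply, fderiv_comp_reflect d, reflect_reflect]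
    linarith
  incompressible := fun t ht x => by
    have d : Differentiable ℝ (u t) :=
      (contDiff_slice h.smooth_velocity ht).differentiable (by simp)
    have e : ∀ v, fderiv ℝ (fun x => reflect (u t (reflect x))) x v =
        reflect (fderiv ℝ (u t) (reflect x) (reflect v)) := by
      intro v
      rw [← fderiv_comp_reflect d]
      have hd : DifferentiableAt ℝ (fun x => u t (reflect x)) x :=
        (d _).comp x reflect.toContinuousLinearEquiv.differentiableAt
      have : HasFDerivAt (fun x => reflect (u t (reflect x))) _ x :=
        reflect.toContinuousLinearEquiv.hasFDerivAt.comp x hd.hasFDerivAt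
      rw [this.fderiv]
      rfl
    have h1 := h.incompressible t ht (reflect x)
    simp only [planeDiv, Fin.sum_univ_two] at h1 ⊢
    rw [e, e, reflect_single_zero, reflect_single_one]
    simpa using h1
  darcy := fun t ht x => by
    have d : Differentiable ℝ (p t) := (h.smooth_pressure t ht).differentiable (by simp)
    rw [gradient_comp_reflect d, ← map_add, h.darcy t ht]
    ext i; fin_cases i <;> simp

section odd

variable (hc : HasCompactSupport ρ₀) (hodd : ∀ x, ρ₀ (reflect x) = -ρ₀ x)
include hc hodd

theorem density_odd {t : ℝ} (ht : 0 ≤ t) (x : Plane) : ρ t (reflect x) = -ρ t x := by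
  have := h.density_unique (h.reflected hodd) hc ht x
  linarith

theorem velocity_reflect {t : ℝ} (ht : 0 ≤ t) (x : Plane) : u t (reflect x) = reflect (u t x) := by
  have := congrFun (h.velocity_unique (h.reflected hodd) hc ht) x
  rw [this, reflect_reflect]

/-- The sign of the density in the upper half plane is preserved, because characteristics do not
cross the axis `x₂ = 0`: a characteristic which meets the axis coincides with its reflection from
then on. -/
theorem density_nonneg (hpos : ∀ x : Plane, 0 < x 1 → 0 ≤ ρ₀ x) {t : ℝ} (ht : 0 ≤ t) {x : Plane}
    (hx : 0 < x 1) : 0 ≤ ρ t x := by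
  obtain ⟨X, rfl, hX⟩ := h.exists_characteristic ht x
  rw [h.density_eq_of_characteristic ht hX]
  rcases lt_trichotomy (X 0 1) 0 with hneg | hzero | hp
  · exfalso
    have hXc : ContinuousOn X (Set.Icc 0 t) := fun τ hτ => (hX τ hτ).continuousWithinAt
    have hXc1 : ContinuousOn (fun τ => X τ 1) (Set.Icc 0 t) :=
      (EuclideanSpace.proj (𝕜 := ℝ) (1 : Fin 2)).continuous.comp_continuousOn hXc
    obtain ⟨σ, hσ, hσ0⟩ := intermediate_value_Icc ht hXc1 ⟨hneg.le, hx.le⟩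
    obtain ⟨R, hR⟩ := (isCompact_Icc.image_of_continuousOn hXc).isBounded.subset_closedBall 0
    obtain ⟨K, hK⟩ := exists_lipschitzOnWith h.smooth_velocity t R 0
    have hsub : Set.Icc σ t ⊆ Set.Icc 0 t := Set.Icc_subset_Icc_left hσ.1
    have hXd : ∀ τ ∈ Set.Ico σ t, HasDerivWithinAt X (u τ (X τ)) (Set.Ici τ) τ := fun τ hτ =>
      (hX τ ⟨hσ.1.trans hτ.1, hτ.2.le⟩).mono_of_mem_nhdsWithin
        (mem_of_superset (Icc_mem_nhdsGE hτ.2) (Set.Icc_subset_Icc_left (hσ.1.trans hτ.1)))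
    have hball : ∀ τ ∈ Set.Ico σ t, X τ ∈ Metric.closedBall (0 : Plane) R := fun τ hτ =>
      hR (Set.mem_image_of_mem X ⟨hσ.1.trans hτ.1, hτ.2.le⟩)
    have heq := ODE_solution_unique_of_mem_Icc_right (v := u) (K := K) (f := X)
      (g := fun τ => reflect (X τ)) (s := fun _ => Metric.closedBall 0 R) (a := σ) (b := t)
      (fun τ hτ => hK τ ⟨hσ.1.trans hτ.1, hτ.2.le⟩) (hXc.mono hsub) hXd hball
      (reflect.continuous.comp_continuousOn (hXc.mono hsub)) ?_ ?_ ?_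
    · have h1 := congrArg (fun v : Plane => v 1) (heq (Set.right_mem_Icc.2 hσ.2))
      simp only [reflect_apply_one] at h1
      linarith
    · intro τ hτ
      rw [h.velocity_reflect hc hodd (hσ.1.trans hτ.1)]
      exact reflect.toContinuousLinearEquiv.hasFDerivAt.comp_hasDerivWithinAt τ (hXd τ hτ)
    · intro τ hτ
      simpa using hball τ hτ
    · ext i; fin_cases i
      · simp
      · have : X σ 1 = 0 := hσ0
        simp [this]
  · have h1 : reflect (X 0) = X 0 := by
      ext i; fin_cases i <;> simp [hzero]
    have h2 := hodd (X 0)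
    rw [h1] at h2
    linarith
  · exact hpos _ hp

/-- The potential energy `∫ x₂ ρ` stays nonnegative. -/
theorem energy_nonneg (hpos : ∀ x : Plane, 0 < x 1 → 0 ≤ ρ₀ x) {t : ℝ} (ht : 0 ≤ t) :
    0 ≤ ∫ x : Plane, x 1 * ρ t x := by
  refine integral_nonneg fun x => ?_
  rcases lt_trichotomy (x 1) 0 with hx | hx | hx
  · have h1 := h.density_nonneg hc hodd hpos ht (x := reflect x) (by simpa using hx)
    rw [h.density_odd hc hodd ht] at h1
    exact mul_nonneg_of_nonpos_of_nonpos hx.le (by linarith)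
  · simp [hx]
  · exact mul_nonneg hx.le (h.density_nonneg hc hodd hpos ht hx)

end odd

/-- The potential energy `∫ x₂ ρ` decreases at the rate `∫ η₁² / |η|² |ρ̂|²`. -/
theorem hasDerivAt_energy (hc : HasCompactSupport ρ₀) {t : ℝ} (ht : 0 < t) :
    HasDerivAt (fun τ => ∫ x : Plane, x 1 * ρ τ x)
      (-∫ η : Plane, η 0 ^ 2 / ‖η‖ ^ 2 * ‖𝓕 (fun x => (ρ t x : ℂ)) η‖ ^ 2) t := by
  have hcs := (h.hasUniformSupport hc).hasCompactSupport ht.le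
  have hρ := contDiff_slice h.smooth_density ht.le
  have h1 := h.hasDerivAt_integral_weighted hc (a := fun x : Plane => x 1) (β := id)
    (EuclideanSpace.proj (𝕜 := ℝ) (1 : Fin 2)).contDiff contDiff_id rfl ht
  let S := schwartzOfReal (ρ t) hρ hcs
  have h2 := integral_mul_velocity S (fun _ => rfl) hcs hρ.continuous
    (contDiff_slice h.smooth_velocity ht.le).continuous (h.velocity_eq ht.le S fun _ => rfl)
  have e : ∀ x v : Plane, fderiv ℝ (fun x : Plane => x 1) x v = v 1 := fun x v => by
    have := (EuclideanSpace.proj (𝕜 := ℝ) (1 : Fin 2)).hasFDerivAt (x := x)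
    rw [show (fun x : Plane => x 1) = EuclideanSpace.proj (𝕜 := ℝ) (1 : Fin 2) from rfl,
      this.fderiv]
    rfl
  refine h1.congr_deriv ?_
  refine Eq.trans ?_ h2
  simp only [e, id, mul_comm]

/-- The dissipation rate is integrable in time, with integral at most the initial energy. -/
theorem lintegral_dissipation_le (hc : HasCompactSupport ρ₀)
    (hodd : ∀ x, ρ₀ (reflect x) = -ρ₀ x) (hpos : ∀ x : Plane, 0 < x 1 → 0 ≤ ρ₀ x) :
    ∫⁻ t in Set.Ioi (0 : ℝ), ENNReal.ofReal
      (∫ η : Plane, η 0 ^ 2 / ‖η‖ ^ 2 * ‖𝓕 (fun x => (ρ t x : ℂ)) η‖ ^ 2) ≤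
    ENNReal.ofReal (∫ x : Plane, x 1 * ρ₀ x) := by
  set δ : ℝ → ℝ := fun t =>
    ∫ η : Plane, η 0 ^ 2 / ‖η‖ ^ 2 * ‖𝓕 (fun x => (ρ t x : ℂ)) η‖ ^ 2 with hδ
  set E : ℝ → ℝ := fun t => ∫ x : Plane, x 1 * ρ t x with hE
  have hδ0 : ∀ t, 0 ≤ δ t := fun t => integral_nonneg fun η => by positivity
  have hEc : ContinuousOn E (Set.Ici 0) :=
    h.continuousOn_integral_weighted hc (a := fun x : Plane => x 1) (β := id)
      (EuclideanSpace.proj (𝕜 := ℝ) (1 : Fin 2)).contDiff contDiff_id rfl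
  have hEd : ∀ t ∈ Set.Ioi (0 : ℝ), HasDerivAt E (-δ t) t := fun t ht => h.hasDerivAt_energy hc ht
  have hE0 : ∀ t, 0 ≤ t → 0 ≤ E t := fun t ht => h.energy_nonneg hc hodd hpos ht
  have hanti : AntitoneOn E (Set.Ici 0) := by
    refine antitoneOn_of_deriv_nonpos (convex_Ici 0) hEc ?_ ?_ <;> rw [interior_Ici] <;>
      intro t ht
    · exact (hEd t ht).differentiableAt.differentiableWithinAt
    · rw [(hEd t ht).deriv]; linarith [hδ0 t]
  -- The energy is monotone and bounded below, hence converges.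
  obtain ⟨l, hl⟩ : ∃ l, Tendsto E atTop (𝓝 l) := by
    have hanti' : Antitone fun t => E (max t 0) := fun s t hst =>
      hanti (le_max_right s 0) (le_max_right t 0) (max_le_max_right 0 hst)
    refine ⟨_, (tendsto_atTop_ciInf hanti' ⟨0, ?_⟩).congr' ?_⟩
    · rintro _ ⟨t, rfl⟩
      exact hE0 _ (le_max_right _ _)
    · filter_upwards [eventually_ge_atTop 0] with t ht
      rw [max_eq_left ht]
  have hl0 : 0 ≤ l := ge_of_tendsto hl (by
    filter_upwards [eventually_ge_atTop 0] with t ht using hE0 t ht)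
  have hint := integrableOn_Ioi_deriv_of_nonpos (hEc 0 Set.self_mem_Ici) hEd
    (fun t _ => by linarith [hδ0 t]) hl
  have hval := integral_Ioi_of_hasDerivAt_of_nonpos (hEc 0 Set.self_mem_Ici) hEd
    (fun t _ => by linarith [hδ0 t]) hl
  have hint' : IntegrableOn δ (Set.Ioi 0) := by simpa using hint.neg
  rw [← ofReal_integral_eq_lintegral_ofReal hint' (ae_of_all _ hδ0)]
  refine ENNReal.ofReal_le_ofReal ?_
  rw [integral_neg] at hval
  have : E 0 = ∫ x : Plane, x 1 * ρ₀ x := by simp [hE, h.initial]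
  linarith

end IsGlobalSmoothIPMSolution

/-! ### From small dissipation to large Sobolev norms -/

theorem volume_box_le {a b : ℝ} (ha : 0 ≤ a) :
    volume {η : Plane | |η 0| ≤ a ∧ |η 1| ≤ b} ≤ ENNReal.ofReal (4 * a * b) := by
  have h1 : {η : Plane | |η 0| ≤ a ∧ |η 1| ≤ b} =
      WithLp.ofLp ⁻¹' Set.Icc (![-a, -b] : Fin 2 → ℝ) ![a, b] := by
    ext η
    simp [Pi.le_def, Fin.forall_fin_two, abs_le]
    tauto
  rw [h1, (PiLp.volume_preserving_ofLp (Fin 2)).measure_preimage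
    measurableSet_Icc.nullMeasurableSet, Real.volume_Icc_pi]
  simp only [Fin.prod_univ_two, Matrix.cons_val_zero, Matrix.cons_val_one]
  rw [← ENNReal.ofReal_mul (by linarith)]
  exact ENNReal.ofReal_le_ofReal (by linarith)

/-- If the Fourier mass of a function is at least `N`, its Fourier density is at most `B`, and
the part of the mass weighted by `η₁² / |η|²` is at most `δ`, then most of the mass is in a thin
cone around the `η₂` axis, hence at high frequencies since the mass of the cone below frequency
`R` is at most of order `√δ R²`. -/
theorem sobolev_lower_bound {f : Plane → ℂ} (hf : Measurable f) {N B δ s : ℝ} (hN : 0 < N)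
    (hB : 0 < B) (hδ : 0 < δ) (hs : 0 < s)
    (hmass : ENNReal.ofReal N ≤ ∫⁻ η, ‖f η‖ₑ ^ (2 : ℝ))
    (hbound : ∀ η, ‖f η‖ₑ ^ (2 : ℝ) ≤ ENNReal.ofReal B)
    (hdiss : ∫⁻ η : Plane, ENNReal.ofReal (η 0 ^ 2 / ‖η‖ ^ 2) * ‖f η‖ₑ ^ (2 : ℝ) ≤
      ENNReal.ofReal δ) :
    ENNReal.ofReal (N / 2 * (N / (16 * B * √(4 * δ / N))) ^ s) ≤
      ∫⁻ η, ‖η‖ₑ ^ (2 * s) * ‖f η‖ₑ ^ (2 : ℝ) := by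
  -- The opening of the cone is such that at most a quarter of the mass lies outside of it, and the
  -- frequency `R` such that at most another quarter lies inside below frequency `R`.
  set l : ℝ := √(4 * δ / N) with hl
  have hl0 : 0 < l := by positivity
  have hl2 : l ^ 2 = 4 * δ / N := Real.sq_sqrt (by positivity)
  set Q : ℝ := N / (16 * B * l) with hQ
  have hQ0 : 0 < Q := by positivity
  set R : ℝ := √Q with hR
  have hR0 : 0 < R := by positivity
  have hR2 : R ^ 2 = Q := Real.sq_sqrt hQ0.le
  have hRs : R ^ (2 * s) = Q ^ s := by
    rw [Real.rpow_mul hR0.le, Real.rpow_two, hR2]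
  have hQs : 0 < Q ^ s := Real.rpow_pos_of_pos hQ0 s
  set A : Set Plane := {η | |η 0| ≤ l * R ∧ |η 1| ≤ R} with hA
  have hAm : MeasurableSet A := by
    refine MeasurableSet.inter ?_ ?_
    · exact measurableSet_le (f := fun η : Plane => |η 0|) (by fun_prop) measurable_const
    · exact measurableSet_le (f := fun η : Plane => |η 1|) (by fun_prop) measurable_const
  have hgm : Measurable fun η => ‖f η‖ₑ ^ (2 : ℝ) := by fun_prop
  have pointwise : ∀ η : Plane, ‖f η‖ₑ ^ (2 : ℝ) ≤
      ENNReal.ofReal (l ^ 2)⁻¹ * (ENNReal.ofReal (η 0 ^ 2 / ‖η‖ ^ 2) * ‖f η‖ₑ ^ (2 : ℝ)) +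
      A.indicator (fun _ => ENNReal.ofReal B) η +
      ENNReal.ofReal (Q ^ s)⁻¹ * (‖η‖ₑ ^ (2 * s) * ‖f η‖ₑ ^ (2 : ℝ)) := by
    intro η
    by_cases h1 : R ≤ ‖η‖
    · refine le_trans ?_ le_add_self
      rw [← mul_assoc]
      refine le_mul_of_one_le_left (zero_le) ?_
      rw [← ofReal_norm, ENNReal.ofReal_rpow_of_pos (hR0.trans_le h1),
        ← ENNReal.ofReal_mul (by positivity), ENNReal.one_le_ofReal, ← hRs,
        inv_mul_eq_div, one_le_div (by positivity)]
      exact Real.rpow_le_rpow hR0.le h1 (by positivity)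
    · push Not at h1
      by_cases h2 : |η 0| ≤ l * ‖η‖
      · have h3 : η ∈ A := by
          refine ⟨h2.trans (by gcongr), ?_⟩
          have := PiLp.norm_apply_le η 1
          exact this.trans h1.le
        rw [Set.indicator_of_mem h3]
        exact (hbound η).trans (le_add_self.trans le_self_add)
      · push Not at h2
        have hη : 0 < ‖η‖ := by
          rw [norm_pos_iff]
          rintro rfl
          simp at h2
        refine le_trans ?_ (le_self_add.trans le_self_add)
        rw [← mul_assoc]
        refine le_mul_of_one_le_left (zero_le) ?_
        rw [← ENNReal.ofReal_mul (by positivity), ENNReal.one_le_ofReal, inv_mul_eq_div,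
          div_div, one_le_div (by positivity), ← sq_abs (η 0), ← mul_pow, mul_comm]
        exact pow_le_pow_left₀ (by positivity) h2.le 2
  have hsum : ENNReal.ofReal N ≤ ENNReal.ofReal (N / 2) +
      ENNReal.ofReal (Q ^ s)⁻¹ * ∫⁻ η, ‖η‖ₑ ^ (2 * s) * ‖f η‖ₑ ^ (2 : ℝ) := by
    refine hmass.trans ((lintegral_mono pointwise).trans ?_)
    rw [lintegral_add_right _ (by fun_prop),
      lintegral_add_right _ (by fun_prop (disch := assumption)),
      lintegral_const_mul' _ _ ENNReal.ofReal_ne_top,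
      lintegral_const_mul' _ _ ENNReal.ofReal_ne_top,
      lintegral_indicator_const hAm]
    gcongr
    calc _ ≤ ENNReal.ofReal (l ^ 2)⁻¹ * ENNReal.ofReal δ +
          ENNReal.ofReal B * ENNReal.ofReal (4 * (l * R) * R) := by
          gcongr
          exact volume_box_le (by positivity)
      _ = ENNReal.ofReal (N / 2) := by
          rw [← ENNReal.ofReal_mul (by positivity), ← ENNReal.ofReal_mul hB.le,
            ← ENNReal.ofReal_add (by positivity) (by positivity)]
          congr 1
          rw [show B * (4 * (l * R) * R) = 4 * B * l * R ^ 2 by ring, hR2, hl2, hQ]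
          field_simp
          ring
  have h2 : ENNReal.ofReal (N / 2) ≤
      ENNReal.ofReal (Q ^ s)⁻¹ * ∫⁻ η, ‖η‖ₑ ^ (2 * s) * ‖f η‖ₑ ^ (2 : ℝ) := by
    rw [show ENNReal.ofReal N = ENNReal.ofReal (N / 2) + ENNReal.ofReal (N / 2) by
      rw [← ENNReal.ofReal_add (by positivity) (by positivity)]; congr 1; ring] at hsum
    exact (ENNReal.add_le_add_iff_left ENNReal.ofReal_ne_top).1 hsum
  calc ENNReal.ofReal (N / 2 * Q ^ s) = ENNReal.ofReal (Q ^ s) * ENNReal.ofReal (N / 2) := by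
        rw [← ENNReal.ofReal_mul hQs.le, mul_comm]
    _ ≤ ENNReal.ofReal (Q ^ s) *
        (ENNReal.ofReal (Q ^ s)⁻¹ * ∫⁻ η, ‖η‖ₑ ^ (2 * s) * ‖f η‖ₑ ^ (2 : ℝ)) := by gcongr
    _ = _ := by
        rw [← mul_assoc, ← ENNReal.ofReal_mul hQs.le, mul_inv_cancel₀ hQs.ne', ENNReal.ofReal_one,
          one_mul]

theorem planeFourier_smul (f : Plane → ℝ) (η : Plane) :
    planeFourier f ((2 * Real.pi) • η) =
      (1 / (2 * Real.pi) : ℂ) * 𝓕 (fun x => (f x : ℂ)) η := by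
  rw [planeFourier, Real.fourier_eq']
  congr 2
  ext x
  rw [smul_eq_mul]
  congr 2
  rw [inner_smul_left, real_inner_comm]
  simp
  ring

/-- Passing from angular frequencies `ξ = 2πη` to the normalization of `𝓕` costs a factor
`(2π)^{2s}`, which is at least one. -/
theorem le_hsNorm {s : ℝ} (hs : 0 < s) (f : Plane → ℝ) :
    (∫⁻ η : Plane, ‖η‖ₑ ^ (2 * s) * ‖𝓕 (fun x => (f x : ℂ)) η‖ₑ ^ (2 : ℝ)) ^ (1 / 2 : ℝ) ≤
      hsNorm s f := by
  have hpi := Real.pi_pos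
  have h2pi : 0 < 2 * Real.pi := by positivity
  unfold hsNorm
  refine ENNReal.rpow_le_rpow ?_ (by norm_num)
  set F : Plane → ENNReal := fun ξ => ‖ξ‖ₑ ^ (2 * s) * ‖planeFourier f ξ‖ₑ ^ (2 : ℝ) with hF
  have h1 : ∫⁻ η, F ((2 * Real.pi) • η) = ENNReal.ofReal ((2 * Real.pi) ^ 2)⁻¹ * ∫⁻ ξ, F ξ := by
    have h2 := Measure.map_addHaar_smul (volume : Measure Plane) h2pi.ne'
    have h3 := lintegral_map_equiv (μ := (volume : Measure Plane)) F
      (MeasurableEquiv.smul₀ (2 * Real.pi) h2pi.ne')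
    simp only [MeasurableEquiv.coe_smul₀] at h3
    rw [← h3, h2, lintegral_smul_measure, finrank_euclideanSpace, Fintype.card_fin,
      abs_of_pos (by positivity), smul_eq_mul]
  have h4 : ∫⁻ ξ, F ξ = ENNReal.ofReal ((2 * Real.pi) ^ 2) * ∫⁻ η, F ((2 * Real.pi) • η) := by
    rw [h1, ← mul_assoc, ← ENNReal.ofReal_mul (by positivity), mul_inv_cancel₀ (by positivity),
      ENNReal.ofReal_one, one_mul]
  rw [h4, ← lintegral_const_mul' _ _ ENNReal.ofReal_ne_top]
  refine lintegral_mono fun η => ?_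
  simp only [hF]
  rw [planeFourier_smul, enorm_smul, enorm_mul (1 / (2 * Real.pi) : ℂ),
    ENNReal.mul_rpow_of_nonneg _ _ (by positivity), ENNReal.mul_rpow_of_nonneg _ _ (by positivity)]
  have e1 : (1 : ENNReal) ≤ ‖2 * Real.pi‖ₑ ^ (2 * s) := by
    refine ENNReal.one_le_rpow ?_ (by positivity)
    rw [← ofReal_norm, ENNReal.one_le_ofReal, Real.norm_of_nonneg h2pi.le]
    linarith [Real.pi_gt_three]
  have e2 : ENNReal.ofReal ((2 * Real.pi) ^ 2) * ‖(1 / (2 * Real.pi) : ℂ)‖ₑ ^ (2 : ℝ) = 1 := by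
    have : ‖(1 / (2 * Real.pi) : ℂ)‖ = (2 * Real.pi)⁻¹ := by
      simp [abs_of_pos hpi]
    rw [← ofReal_norm, this, ENNReal.ofReal_rpow_of_pos (by positivity),
      ← ENNReal.ofReal_mul (by positivity), Real.rpow_two, ← mul_pow,
      mul_inv_cancel₀ h2pi.ne', one_pow, ENNReal.ofReal_one]
  set a := ‖η‖ₑ ^ (2 * s)
  set b := ‖𝓕 (fun x => (f x : ℂ)) η‖ₑ ^ (2 : ℝ)
  set c := ‖2 * Real.pi‖ₑ ^ (2 * s)
  set d := ‖(1 / (2 * Real.pi) : ℂ)‖ₑ ^ (2 : ℝ)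
  calc a * b = 1 * (a * b) := (one_mul _).symm
    _ ≤ c * (a * b) := by gcongr
    _ = (ENNReal.ofReal ((2 * Real.pi) ^ 2) * d) * (c * (a * b)) := by rw [e2, one_mul]
    _ = _ := by ring

/-- The pointwise in time bound: a power of the Sobolev norm is controlled by the dissipation
rate of the potential energy. -/
theorem hsNorm_rpow_le {f : Plane → ℝ} (hf : ContDiff ℝ ((⊤ : ℕ∞) : WithTop ℕ∞) f)
    (hc : HasCompactSupport f) {N M s : ℝ} (hN : 0 < N) (hs : 0 < s)
    (hfN : ∫ x, f x ^ 2 = N) (hfM : ∫ x, |f x| ≤ M) :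
    hsNorm s f ^ (-(4 / s)) ≤
      ENNReal.ofReal ((N / 2) ^ (-(2 / s)) * (1024 * (M ^ 2 + 1) ^ 2 / N ^ 3)) * ENNReal.ofReal
        (∫ η : Plane, η 0 ^ 2 / ‖η‖ ^ 2 * ‖𝓕 (fun x => (f x : ℂ)) η‖ ^ 2) := by
  set δ := ∫ η : Plane, η 0 ^ 2 / ‖η‖ ^ 2 * ‖𝓕 (fun x => (f x : ℂ)) η‖ ^ 2 with hδ
  set S := schwartzOfReal f hf hc
  set g : Plane → ℂ := 𝓕 (fun x => (f x : ℂ)) with hg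
  have hgS : ∀ η, g η = 𝓕 S η := fun η => rfl
  have hgc : Continuous g := (𝓕 S).continuous
  have hsq : ∀ η, ‖g η‖ₑ ^ (2 : ℝ) = ENNReal.ofReal (‖g η‖ ^ 2) := fun η => by
    rw [← ofReal_norm, ENNReal.ofReal_rpow_of_nonneg (norm_nonneg _) (by norm_num),
      Real.rpow_two]
  have hgi : Integrable fun η => ‖g η‖ ^ 2 := integrable_sq_fourier S
  have hmass : ENNReal.ofReal N ≤ ∫⁻ η, ‖g η‖ₑ ^ (2 : ℝ) := by
    simp only [hsq]
    rw [← ofReal_integral_eq_lintegral_ofReal hgi (ae_of_all _ fun η => sq_nonneg _), ← hfN]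
    exact (congrArg ENNReal.ofReal (integral_sq_fourier (S := S) (θ := f) fun _ => rfl)).ge
  have hbound : ∀ η, ‖g η‖ₑ ^ (2 : ℝ) ≤ ENNReal.ofReal (M ^ 2 + 1) := fun η => by
    rw [hsq]
    refine ENNReal.ofReal_le_ofReal ?_
    have h1 : ‖g η‖ ≤ ∫ x, ‖(f x : ℂ)‖ :=
      VectorFourier.norm_fourierIntegral_le_integral_norm _ _ _ _ _
    simp only [Complex.norm_real, Real.norm_eq_abs] at h1
    have := pow_le_pow_left₀ (norm_nonneg _) (h1.trans hfM) 2
    linarith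
  have hint : Integrable fun η : Plane => η 0 ^ 2 / ‖η‖ ^ 2 * ‖g η‖ ^ 2 := by
    refine hgi.bdd_mul (c := 1) ?_ (ae_of_all _ fun η => ?_)
    · exact Measurable.aestronglyMeasurable (by fun_prop)
    · rw [Real.norm_of_nonneg (by positivity), norm_sq_plane]
      exact div_le_one_of_le₀ (by nlinarith [sq_nonneg (η 1)]) (by positivity)
  have hdiss : ∫⁻ η : Plane, ENNReal.ofReal (η 0 ^ 2 / ‖η‖ ^ 2) * ‖g η‖ₑ ^ (2 : ℝ) =
      ENNReal.ofReal δ := by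
    rw [hδ, ofReal_integral_eq_lintegral_ofReal hint (ae_of_all _ fun η => by positivity)]
    refine lintegral_congr fun η => ?_
    rw [hsq, ← ENNReal.ofReal_mul (by positivity)]
  have hδ0 : 0 ≤ δ := integral_nonneg fun η => by positivity
  set K := (N / 2) ^ (-(2 / s)) * (1024 * (M ^ 2 + 1) ^ 2 / N ^ 3) with hK
  have hN2 : (0 : ℝ) < (N / 2) ^ (-(2 / s)) := Real.rpow_pos_of_pos (by positivity) _
  have hK0 : 0 ≤ K := by positivity
  -- The lower bound needs a positive dissipation rate: use it for `δ' > δ` and let `δ' → δ`.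
  have key : ∀ δ' : ℝ, δ < δ' → hsNorm s f ^ (-(4 / s)) ≤ ENNReal.ofReal (K * δ') := by
    intro δ' hδ'
    have hδ'0 : 0 < δ' := hδ0.trans_lt hδ'
    have hB : 0 < M ^ 2 + 1 := by positivity
    set l := √(4 * δ' / N) with hl
    have hl0 : 0 < l := by positivity
    have hl2 : l ^ 2 = 4 * δ' / N := Real.sq_sqrt (by positivity)
    set Q := N / (16 * (M ^ 2 + 1) * l) with hQ
    have hQ0 : 0 < Q := by positivity
    have hc0 : 0 < N / 2 * Q ^ s := mul_pos (by positivity) (Real.rpow_pos_of_pos hQ0 s)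
    have h1 := sobolev_lower_bound hgc.measurable hN hB hδ'0 hs hmass hbound
      (hdiss.le.trans (ENNReal.ofReal_le_ofReal hδ'.le))
    have h2 := (ENNReal.rpow_le_rpow h1 (by norm_num : (0 : ℝ) ≤ 1 / 2)).trans (le_hsNorm hs f)
    rw [ENNReal.ofReal_rpow_of_pos hc0] at h2
    have h3 := ENNReal.rpow_le_rpow h2 (by positivity : 0 ≤ 4 / s)
    rw [ENNReal.rpow_neg]
    refine (ENNReal.inv_le_inv.2 h3).trans ?_
    rw [← ENNReal.rpow_neg, ENNReal.ofReal_rpow_of_pos (Real.rpow_pos_of_pos hc0 _)]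
    refine ENNReal.ofReal_le_ofReal (le_of_eq ?_)
    rw [← Real.rpow_mul hc0.le, Real.mul_rpow (by positivity) (Real.rpow_nonneg hQ0.le s),
      ← Real.rpow_mul hQ0.le, show 1 / 2 * -(4 / s) = -(2 / s) by ring,
      show s * -(2 / s) = -2 by field_simp, Real.rpow_neg hQ0.le, Real.rpow_two, hK, mul_assoc]
    congr 1
    rw [hQ, div_pow, mul_pow, hl2]
    field_simp
    ring
  rw [← ENNReal.ofReal_mul hK0]
  have hlim : Tendsto (fun δ' => ENNReal.ofReal (K * δ')) (𝓝[>] δ) (𝓝 (ENNReal.ofReal (K * δ))) :=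
    (ENNReal.continuous_ofReal.comp (continuous_const.mul continuous_id)).continuousWithinAt
  exact ge_of_tendsto hlim (by filter_upwards [self_mem_nhdsWithin] with δ' h' using key δ' h')

/-- A function with `F ^ (-(4/s))` integrable at infinity grows faster than `t ^ (s/4)` along a
sequence of times. -/
theorem limsup_eq_top_of_lintegral_ne_top {F : ℝ → ENNReal} {s : ℝ} (hs : 0 < s)
    (hF : ∫⁻ t in Set.Ioi (0 : ℝ), F t ^ (-(4 / s)) ≠ ⊤) :
    limsup (fun t : ℝ => ENNReal.ofReal (t ^ (-(s / 4))) * F t) atTop = ⊤ := by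
  by_contra hne
  obtain ⟨K, hK1, hK2⟩ := ENNReal.lt_iff_exists_nnreal_btwn.1 (lt_top_iff_ne_top.2 hne)
  have hK0 : (K : ENNReal) ≠ 0 := (bot_le.trans_lt hK1).ne'
  obtain ⟨T, hT⟩ := eventually_atTop.1 (eventually_lt_of_limsup_lt hK1)
  set T' := max T 1
  have hT'0 : 0 < T' := lt_max_of_lt_right one_pos
  have hpt : ∀ t ∈ Set.Ioi T', (K : ENNReal) ^ (-(4 / s)) * ENNReal.ofReal t⁻¹ ≤
      F t ^ (-(4 / s)) := by
    intro t ht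
    have ht0 : 0 < t := hT'0.trans ht
    have h1 := (hT t ((le_max_left _ _).trans (le_of_lt ht))).le
    have hp : 0 < t ^ (s / 4) := Real.rpow_pos_of_pos ht0 _
    have h2 : F t ≤ K * ENNReal.ofReal (t ^ (s / 4)) := by
      calc F t = (ENNReal.ofReal (t ^ (-(s / 4))) * F t) * ENNReal.ofReal (t ^ (s / 4)) := by
            rw [mul_right_comm, ← ENNReal.ofReal_mul (Real.rpow_nonneg ht0.le _),
              ← Real.rpow_add ht0, neg_add_cancel, Real.rpow_zero, ENNReal.ofReal_one, one_mul]
        _ ≤ _ := by gcongr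
    have h3 := ENNReal.rpow_le_rpow h2 (by positivity : 0 ≤ 4 / s)
    calc (K : ENNReal) ^ (-(4 / s)) * ENNReal.ofReal t⁻¹
        = (K * ENNReal.ofReal (t ^ (s / 4))) ^ (-(4 / s)) := by
          rw [ENNReal.mul_rpow_of_ne_top ENNReal.coe_ne_top ENNReal.ofReal_ne_top,
            ENNReal.ofReal_rpow_of_pos hp, ← Real.rpow_mul ht0.le,
            show s / 4 * -(4 / s) = -1 by field_simp, Real.rpow_neg_one]
      _ ≤ _ := by
          rw [ENNReal.rpow_neg, ENNReal.rpow_neg]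
          exact ENNReal.inv_le_inv.2 h3
  have hinv : ∫⁻ t in Set.Ioi T', ENNReal.ofReal t⁻¹ = ⊤ := by
    by_contra hfin
    refine not_integrableOn_Ioi_inv (a := T') ⟨measurable_inv.aestronglyMeasurable, ?_⟩
    rw [hasFiniteIntegral_iff_ofReal]
    · exact lt_top_iff_ne_top.2 hfin
    · filter_upwards [ae_restrict_mem measurableSet_Ioi] with t ht
      exact inv_nonneg.2 (hT'0.trans ht).le
  have hKne : (K : ENNReal) ^ (-(4 / s)) ≠ ⊤ := by
    rw [ne_eq, ENNReal.rpow_eq_top_iff]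
    simp [hK0]
  have hKne0 : (K : ENNReal) ^ (-(4 / s)) ≠ 0 := by
    rw [ne_eq, ENNReal.rpow_eq_zero_iff]
    simp [hK0]
  apply hF
  rw [eq_top_iff]
  calc ⊤ = (K : ENNReal) ^ (-(4 / s)) * ∫⁻ t in Set.Ioi T', ENNReal.ofReal t⁻¹ := by
        rw [hinv, ENNReal.mul_top hKne0]
    _ = ∫⁻ t in Set.Ioi T', (K : ENNReal) ^ (-(4 / s)) * ENNReal.ofReal t⁻¹ :=
        (lintegral_const_mul' _ _ hKne).symm
    _ ≤ ∫⁻ t in Set.Ioi T', F t ^ (-(4 / s)) := setLIntegral_mono' measurableSet_Ioi hpt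
    _ ≤ _ := lintegral_mono_set (Set.Ioi_subset_Ioi hT'0.le)

theorem theorem1p1 (ρ₀ : Plane → ℝ)
    (h_smooth : ContDiff ℝ ((⊤ : ℕ∞) : WithTop ℕ∞) ρ₀)
    (h_supp : HasCompactSupport ρ₀)
    (h_odd : ∀ x₁ x₂ : ℝ, ρ₀ !₂[x₁, -x₂] = -ρ₀ !₂[x₁, x₂])
    (h_nonneg : ∀ x₁ x₂ : ℝ, 0 < x₂ → 0 ≤ ρ₀ !₂[x₁, x₂])
    (h_ne : ∃ x : Plane, ρ₀ x ≠ 0) :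
    (∀ s : ℝ, 0 < s → ∃ C : NNReal,
      ∀ (ρ : ℝ → Plane → ℝ) (u : ℝ → Plane → Plane) (p : ℝ → Plane → ℝ),
        IsGlobalSmoothIPMSolution ρ₀ ρ u p →
          ∫⁻ t in Set.Ioi (0 : ℝ), hsNorm s (ρ t) ^ (-(4 / s)) ≤ (C : ENNReal)) ∧
    (∀ (ρ : ℝ → Plane → ℝ) (u : ℝ → Plane → Plane) (p : ℝ → Plane → ℝ),
      IsGlobalSmoothIPMSolution ρ₀ ρ u p →
        ∀ s : ℝ, 0 < s →
          Filter.limsup (fun t : ℝ => ENNReal.ofReal (t ^ (-(s / 4))) * hsNorm s (ρ t))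
            Filter.atTop = ⊤) := by
  have hcoord : ∀ x : Plane, x = !₂[x 0, x 1] := fun x => by ext i; fin_cases i <;> simp
  have hodd : ∀ x, ρ₀ (reflect x) = -ρ₀ x := fun x => by
    rw [hcoord (reflect x), reflect_apply_zero, reflect_apply_one, h_odd, ← hcoord x]
  have hpos : ∀ x : Plane, 0 < x 1 → 0 ≤ ρ₀ x := fun x hx => by
    rw [hcoord x]; exact h_nonneg _ _ hx
  have hN : 0 < ∫ x, ρ₀ x ^ 2 := by
    obtain ⟨x, hx⟩ := h_ne
    have hcont : Continuous fun x => ρ₀ x ^ 2 := h_smooth.continuous.pow 2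
    exact hcont.integral_pos_of_hasCompactSupport_nonneg_nonzero
      (h_supp.comp_left (g := fun r => r ^ 2) (by simp)) (fun y => sq_nonneg _) (pow_ne_zero 2 hx)
  have main : ∀ s : ℝ, 0 < s → ∃ C : NNReal,
      ∀ (ρ : ℝ → Plane → ℝ) (u : ℝ → Plane → Plane) (p : ℝ → Plane → ℝ),
        IsGlobalSmoothIPMSolution ρ₀ ρ u p →
          ∫⁻ t in Set.Ioi (0 : ℝ), hsNorm s (ρ t) ^ (-(4 / s)) ≤ (C : ENNReal) := by
    intro s hs
    set N := ∫ x, ρ₀ x ^ 2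
    set M := ∫ x, |ρ₀ x|
    set K := (N / 2) ^ (-(2 / s)) * (1024 * (M ^ 2 + 1) ^ 2 / N ^ 3)
    refine ⟨K.toNNReal * (∫ x : Plane, x 1 * ρ₀ x).toNNReal, fun ρ u p h => ?_⟩
    calc ∫⁻ t in Set.Ioi (0 : ℝ), hsNorm s (ρ t) ^ (-(4 / s))
        ≤ ∫⁻ t in Set.Ioi (0 : ℝ), ENNReal.ofReal K * ENNReal.ofReal
          (∫ η : Plane, η 0 ^ 2 / ‖η‖ ^ 2 * ‖𝓕 (fun x => (ρ t x : ℂ)) η‖ ^ 2) := by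
          refine setLIntegral_mono' measurableSet_Ioi fun t ht => ?_
          have ht0 : 0 ≤ t := le_of_lt ht
          exact hsNorm_rpow_le (contDiff_slice h.smooth_density ht0)
            ((h.hasUniformSupport h_supp).hasCompactSupport ht0) hN hs
            (h.integral_sq_density h_supp ht0) (h.integral_abs_density_le h_supp ht0)
      _ = ENNReal.ofReal K * ∫⁻ t in Set.Ioi (0 : ℝ), ENNReal.ofReal
          (∫ η : Plane, η 0 ^ 2 / ‖η‖ ^ 2 * ‖𝓕 (fun x => (ρ t x : ℂ)) η‖ ^ 2) :=
          lintegral_const_mul' _ _ ENNReal.ofReal_ne_top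
      _ ≤ ENNReal.ofReal K * ENNReal.ofReal (∫ x : Plane, x 1 * ρ₀ x) := by
          gcongr
          exact h.lintegral_dissipation_le h_supp hodd hpos
      _ = _ := by rw [ENNReal.coe_mul]; rfl
  refine ⟨main, fun ρ u p h s hs => ?_⟩
  obtain ⟨C, hC⟩ := main s hs
  exact limsup_eq_top_of_lintegral_ne_top hs
    ((hC ρ u p h).trans_lt ENNReal.coe_lt_top).ne
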